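/- Let $(a_i)_{i\ge 1}$ and $(b_i)_{i\ge 1}$ be strictly positive real sequences with $\sum_{i\ge1} a_i+\sum_{i\ge1} b_i=1$, and let $\varpi$ be the probability distribution on $\{1,2,\dots\}^2$ with density (with respect to counting measure) $\pi(i,i)=a_i$, $\pi(i+1,i)=b_i$ for $i\ge1$, and $\pi(x,y)=0$ otherwise. Write $\pi_X(x)=\sum_y\pi(x,y)$, $\pi_Y(y)=\sum_x\pi(x,y)$, $\pi_{X|Y}(x|y)=\pi(x,y)/\pi_Y(y)$, $\pi_{Y|X}(y|x)=\pi(x,y)/\pi_X(x)$, and let $\varpi_X$ be the distribution with density $\pi_X$. Fix $p\in(0,1)$ and consider the Markov chains with the following transition densities with respect to counting measure: - the $X$-marginal chain on $\{1,2,\dots\}$: $k_X(x'|x)=\sum_y \pi_{X|Y}(x'|y)\,\pi_{Y|X}(y|x)$; - the deterministic scan Gibbs sampler (DGS) on $\{1,2,\dots\}^2$: $k_{DGS}(x',y'|x,y)=\pi_{X|Y}(x'|y)\,\pi_{Y|X}(y'|x')$; - the random scan Gibbs sampler (RGS) on $\{1,2,\dots\}^2$: $k_{RGS}(x',y'|x,y)=p\,\pi_{X|Y}(x'|y)\,\mathbf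 1_{\{y'=y\}}+(1-p)\,\pi_{Y|X}(y'|x)\,\mathbf 1_{\{x'=x\}}$. A Markov kernel $P$ on $Z$ with invariant probability measure $w$ is called geometrically ergodic if there are a function $M_0:Z\to\mathbb R$ and $t\in(0,1)$ such that $\|P^n(z,\cdot)-w\|_{TV}\le M_0(z)\,t^n$ for all $z\in Z$ and all $n$. Put, in $[0,\infty]$, $$A=\limsup_{i\to\infty}\frac{a_i}{a_{i-1}},\qquad m=\liminf_{i\to\infty}\frac{a_i}{b_i},\qquad M=\limsup_{i\to\infty}\frac{a_i}{b_i}.$$ Suppose that $$\limsup_{i\to\infty}\frac{a_i}{b_{i-1}}<\infty,\qquad \limsup_{i\to\infty}\frac{b_i}{a_i}<\infty,\qquad \frac{A(1+M)}{1+m}<1,$$ where $A(1+M)/(1+m)$ is evaluated in $[0,\infty]$ with the conventions $0\cdot\infty=0$ and $0/\infty=0$. Then the $X$-marginal chain, the DGS chain and the RGS chain are geometrically ergodic, with invariant distributions $\varpi_X$, $\varpi$ and $\varpi$ respectively. -/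

import Mathlib

open MeasureTheory ProbabilityTheory Filter
open scoped ENNReal

noncomputable section

namespace GibbsDiscrete

/-! ### Markov chains and geometric ergodicity -/

/-- Total variation norm of the difference of two finite measures (total mass of the variation
of the signed measure `μ - ν`). -/
def tvNorm {Z : Type*} [MeasurableSpace Z] (μ ν : Measure Z) [IsFiniteMeasure μ]
    [IsFiniteMeasure ν] : ℝ≥0∞ :=
  (μ.toSignedMeasure - ν.toSignedMeasure).totalVariation Set.univ

/-- The `n`-step transition kernel `P ^ n`. -/
def nStep {Z : Type*} [MeasurableSpace Z] (P : Kernel Z Z) : ℕ → Kernel Z Z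
  | 0 => Kernel.id
  | n + 1 => P ∘ₖ nStep P n

instance instIsMarkovKernelNStep {Z : Type*} [MeasurableSpace Z] (P : Kernel Z Z)
    [IsMarkovKernel P] (n : ℕ) : IsMarkovKernel (nStep P n) := by
  induction n with
  | zero => exact inferInstanceAs (IsMarkovKernel Kernel.id)
  | succ n ih => exact inferInstanceAs (IsMarkovKernel (P ∘ₖ nStep P n))

/-- The Markov kernel `P` with invariant probability measure `w` is geometrically ergodic:
there are a real function `M` and `0 < t < 1` with `‖P ^ n (z, ·) - w‖ ≤ M z * t ^ n` for every
state `z` and every `n`. That `P` is a Markov kernel and that `w` is an invariant probability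
measure is part of the assertion. -/
def GeometricallyErgodic {Z : Type*} [MeasurableSpace Z] (P : Kernel Z Z) (w : Measure Z) :
    Prop :=
  ∃ (_ : IsMarkovKernel P) (_ : IsProbabilityMeasure w),
    Kernel.Invariant P w ∧
    ∃ (M : Z → ℝ) (t : ℝ), 0 < t ∧ t < 1 ∧
      ∀ (z : Z) (n : ℕ), tvNorm (nStep P n z) w ≤ ENNReal.ofReal (M z * t ^ n)

/-- The measure on a countable space with density `f` with respect to counting measure. -/
def measureOfDensity {Z : Type*} [MeasurableSpace Z] (f : Z → ℝ) : Measure Z :=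
  Measure.count.withDensity fun z => ENNReal.ofReal (f z)

/-- The kernel `P (z, A) = ∑ z' ∈ A, k z z'` on a countable space; `k z z'` is the transition
density `k (z' | z)` with respect to counting measure. -/
def kernelOfDensity {Z : Type*} [MeasurableSpace Z] [Countable Z] [MeasurableSingletonClass Z]
    (k : Z → Z → ℝ) : Kernel Z Z :=
  Kernel.ofFunOfCountable fun z => measureOfDensity (k z)

/-! ### Two-variable Gibbs samplers on `{1, 2, …} × {1, 2, …}` -/

/-- The positive integers carry the discrete σ-algebra (the Borel σ-algebra of their topology). -/
instance instMeasurableSpacePNat : MeasurableSpace ℕ+ := ⊤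

instance instDiscreteMeasurableSpacePNat : DiscreteMeasurableSpace ℕ+ := ⟨fun _ => trivial⟩

section Gibbs

variable (π : ℕ+ → ℕ+ → ℝ)

/-- Marginal density `π_X`. -/
def margX (x : ℕ+) : ℝ := ∑' y, π x y

/-- Marginal density `π_Y`. -/
def margY (y : ℕ+) : ℝ := ∑' x, π x y

/-- Conditional density `π_{X|Y} (x | y)`. -/
def condX (x y : ℕ+) : ℝ := π x y / margY π y

/-- Conditional density `π_{Y|X} (y | x)`. -/
def condY (y x : ℕ+) : ℝ := π x y / margX π x

/-- The target distribution on pairs. -/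
def target : Measure (ℕ+ × ℕ+) := measureOfDensity fun z => π z.1 z.2

/-- The `X`-marginal of the target distribution. -/
def targetX : Measure ℕ+ := measureOfDensity (margX π)

/-- Kernel of the `X`-marginal chain:
`k_X (x' | x) = ∑ y, π_{X|Y} (x' | y) * π_{Y|X} (y | x)`. -/
def kernelX : Kernel ℕ+ ℕ+ :=
  kernelOfDensity fun x x' => ∑' y, condX π x' y * condY π y x

/-- Kernel of the deterministic scan Gibbs sampler:
`k_DGS (x', y' | x, y) = π_{X|Y} (x' | y) * π_{Y|X} (y' | x')`. -/
def kernelDGS : Kernel (ℕ+ × ℕ+) (ℕ+ × ℕ+) :=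
  kernelOfDensity fun z z' => condX π z'.1 z.2 * condY π z'.2 z'.1

/-- Kernel of the random scan Gibbs sampler with selection probability `p`:
`k_RGS (x', y' | x, y) = p π_{X|Y} (x' | y) δ (y' - y) + (1 - p) π_{Y|X} (y' | x) δ (x' - x)`. -/
def kernelRGS (p : ℝ) : Kernel (ℕ+ × ℕ+) (ℕ+ × ℕ+) :=
  kernelOfDensity fun z z' =>
    p * condX π z'.1 z.2 * (if z'.2 = z.2 then 1 else 0)
      + (1 - p) * condY π z'.2 z.1 * (if z'.1 = z.1 then 1 else 0)

end Gibbs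

/-! ### The discrete family -/

/-- The bivariate density with `π (i, i) = a i`, `π (i + 1, i) = b i`, and `0` elsewhere. -/
def density (a b : ℕ+ → ℝ) (x y : ℕ+) : ℝ :=
  if x = y then a x else if x = y + 1 then b y else 0

/-- The upper limit in `[0, ∞]` of a sequence of nonnegative reals. -/
def limsupENN (u : ℕ+ → ℝ) : ℝ≥0∞ := limsup (fun i => ENNReal.ofReal (u i)) atTop

/-- The lower limit in `[0, ∞]` of a sequence of nonnegative reals. -/
def liminfENN (u : ℕ+ → ℝ) : ℝ≥0∞ := liminf (fun i => ENNReal.ofReal (u i)) atTop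

end GibbsDiscrete

end

namespace GibbsDiscrete

/-! ### Monotone birth and death chains -/

/-! Each sampler is controlled by a reversible birth and death chain on `ℕ`. The `X`-marginal chain
is one with stationary weights `π_X`. The support of `π` is the path (1,1), (2,1), (2,2), (3,2), …,
along which the random scan sampler moves only to neighbours, with stationary weights a₁, b₁, a₂,
b₂, …. In both cases the weight of a state is at most a constant times the conductance of the edge
leading to it from the left, and the conductances decay geometrically up to a constant.

Such a chain with `u k + d k ≤ 1` acts on increments `G (k + 1) - G k` by nonnegative coefficients,
so geometric convergence follows from a positive weight `f` on edges that this action contracts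
(`exists_contracting_weight`). The weight is the increment of a solution of a Poisson equation whose
right-hand side has increments `1 / √c`. Summing increments along the path and averaging against the
stationary law gives `birthDeath_convergence`; the constants do not depend on the test function, so
taking indicators bounds total variation.

The growth hypotheses reduce to three uniform bounds, collected in `GeometricGrowth`: `a (i + 1) ≤ C
* b i`, `b i ≤ D * a i`, and geometric decay of `a`. For the decay, `m = ∞` makes `a (i + 1) ≤ C * b
i` negligible against `a i`; otherwise `m ≤ M` and the product condition force `A < 1`.

The deterministic scan sampler follows from the marginal chain, since averaging its iterates over
`y` given `x` yields a solution of the marginal recursion. For arbitrary starting points, including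
those off the support, one update lands on the support, at the cost of a factor `1 / t`. -/

/-- If `q` decays geometrically up to a constant, then so do its tail sums and the reciprocals of
its partial sums of reciprocals. -/
theorem sum_inv_le_of_geometric {q : ℕ → ℝ} (hq : ∀ k, 0 < q k) {L r : ℝ} (hr0 : 0 < r)
    (hr1 : r < 1) (hL : ∀ k j, q (k + j) ≤ L * r ^ j * q k) (k : ℕ) :
    ∑ i ∈ Finset.range (k + 1), (q i)⁻¹ ≤ L / (1 - r) * (q k)⁻¹ := by
  have hL0 : 0 < L := by
    have := hL 0 0
    simp only [add_zero, pow_zero, mul_one] at this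
    by_contra h
    nlinarith [hq 0]
  have h1 : ∀ i ∈ Finset.range (k + 1), (q i)⁻¹ ≤ L * (q k)⁻¹ * r ^ (k - i) := by
    intro i hi
    have hik : i ≤ k := by simpa [Nat.lt_succ_iff] using hi
    have h := hL i (k - i)
    rw [Nat.add_sub_cancel' hik] at h
    have hi0 := hq i
    have hk0 := hq k
    rw [inv_le_iff_one_le_mul₀ hi0]
    have : L * (q k)⁻¹ * r ^ (k - i) * q i = (L * r ^ (k - i) * q i) / q k := by
      field_simp
    rw [this, le_div_iff₀ hk0]
    simpa using h
  refine (Finset.sum_le_sum h1).trans ?_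
  rw [← Finset.mul_sum]
  have h2 : ∑ i ∈ Finset.range (k + 1), r ^ (k - i) = ∑ i ∈ Finset.range (k + 1), r ^ i :=
    Finset.sum_range_reflect (fun i => r ^ i) (k + 1)
  rw [h2]
  have h3 : ∑ i ∈ Finset.range (k + 1), r ^ i ≤ (1 - r)⁻¹ := by
    rw [← tsum_geometric_of_lt_one hr0.le hr1]
    exact (summable_geometric_of_lt_one hr0.le hr1).sum_le_tsum _ (fun i _ => by positivity)
  calc L * (q k)⁻¹ * ∑ i ∈ Finset.range (k + 1), r ^ i
      ≤ L * (q k)⁻¹ * (1 - r)⁻¹ := by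
        gcongr
        have := hq k
        positivity
    _ = L / (1 - r) * (q k)⁻¹ := by ring

theorem summable_of_geometric {q : ℕ → ℝ} (hq : ∀ k, 0 < q k) {L r : ℝ} (hr0 : 0 < r)
    (hr1 : r < 1) (hL : ∀ k j, q (k + j) ≤ L * r ^ j * q k) : Summable q := by
  refine Summable.of_nonneg_of_le (fun k => (hq k).le) (fun k => ?_)
    ((summable_geometric_of_lt_one hr0.le hr1).mul_left (L * q 0))
  have := hL 0 k
  rw [zero_add] at this
  linarith

theorem tsum_tail_le_of_geometric {q : ℕ → ℝ} (hq : ∀ k, 0 < q k) {L r : ℝ} (hr0 : 0 < r)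
    (hr1 : r < 1) (hL : ∀ k j, q (k + j) ≤ L * r ^ j * q k) (k : ℕ) :
    ∑' j, q (j + k) ≤ L / (1 - r) * q k := by
  have hs := (summable_nat_add_iff k).2 (summable_of_geometric hq hr0 hr1 hL)
  have hg := (summable_geometric_of_lt_one hr0.le hr1).mul_left (L * q k)
  refine (hs.tsum_le_tsum (fun j => ?_) hg).trans ?_
  · have := hL k j
    rw [add_comm j k]
    linarith
  · rw [tsum_mul_left, tsum_geometric_of_lt_one hr0.le hr1]
    apply le_of_eq
    ring

/-- Existence of a weight `f` on the edges of `ℕ` for which the operator induced on increments by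
a birth and death chain is a strict contraction. Here `u k` is the probability of `k → k + 1`,
`d k` that of `k + 1 → k`, `w` the reversible measure and `c` the conductances. -/
theorem exists_contracting_weight {u d w c : ℕ → ℝ} (hw : ∀ k, 0 < w k) (hc : ∀ k, 0 < c k)
    (hwu : ∀ k, w k * u k = c k) (hwd : ∀ k, w (k + 1) * d k = c k)
    (hud : ∀ k, u k + d k ≤ 1) {K L r : ℝ} (hr0 : 0 < r) (hr1 : r < 1)
    (hK : ∀ k, w (k + 1) ≤ K * c k) (hL : ∀ k j, c (k + j) ≤ L * r ^ j * c k) :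
    ∃ (f : ℕ → ℝ) (t δ : ℝ), 0 < t ∧ t < 1 ∧ 0 < δ ∧ (∀ k, δ ≤ f k) ∧
      Summable (fun k => w k * ∑ i ∈ Finset.range k, f i) ∧
      (1 - u 0 - d 0) * f 0 + u 1 * f 1 ≤ t * f 0 ∧
      ∀ k, (1 - u (k + 1) - d (k + 1)) * f (k + 1) + u (k + 2) * f (k + 2) + d k * f k
        ≤ t * f (k + 1) := by
  -- The square root keeps both sums in play geometric: partial sums of `1 / q` are of order `1 /
  -- q`, and tails of `c / q = q` are of order `q`. With `c` itself in place of `q`, the second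
  -- property would be lost.
  set q : ℕ → ℝ := fun k => √(c k) with hqdef
  have hq : ∀ k, 0 < q k := fun k => Real.sqrt_pos.2 (hc k)
  have hqq : ∀ k, q k * q k = c k := fun k => Real.mul_self_sqrt (hc k).le
  have hs0 : 0 < √r := Real.sqrt_pos.2 hr0
  have hs1 : √r < 1 := by
    rw [Real.sqrt_lt' one_pos]
    simpa using hr1
  have hqL : ∀ k j, q (k + j) ≤ √L * √r ^ j * q k := by
    intro k j
    have hL0 : 0 ≤ L := by
      have := hL 0 0
      simp only [add_zero, pow_zero, mul_one] at this
      by_contra h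
      nlinarith [hc 0]
    have h : √(c (k + j)) ≤ √(L * r ^ j * c k) := Real.sqrt_le_sqrt (hL k j)
    rw [Real.sqrt_mul (by positivity), Real.sqrt_mul hL0] at h
    have e : √(r ^ j) = √r ^ j := by
      rw [Real.sqrt_eq_iff_mul_self_eq (by positivity) (by positivity), ← mul_pow,
        Real.mul_self_sqrt hr0.le]
    rwa [e] at h
  have hK0 : 0 < K := by
    by_contra h
    nlinarith [hw 1, hK 0, hc 0]
  set g : ℕ → ℝ := fun k => ∑ i ∈ Finset.range k, (q i)⁻¹ with hgdef
  set C : ℝ := √L / (1 - √r) with hCdef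
  have hgC : ∀ k, g (k + 1) ≤ C * (q k)⁻¹ := sum_inv_le_of_geometric hq hs0 hs1 hqL
  have hgpos : ∀ k, (q 0)⁻¹ ≤ g (k + 1) := by
    intro k
    have := Finset.single_le_sum (f := fun i => (q i)⁻¹) (s := Finset.range (k + 1))
      (fun i _ => (inv_pos.2 (hq i)).le) (Finset.mem_range.2 (Nat.succ_pos k))
    simpa using this
  have hg0 : ∀ k, 0 < g (k + 1) := fun k => (inv_pos.2 (hq 0)).trans_le (hgpos k)
  have hC0 : 0 < C := by
    by_contra h
    have h1 := hgC 0
    have h2 := hg0 0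
    have h3 := inv_pos.2 (hq 0)
    nlinarith
  set S : ℕ → ℝ := fun k => w (k + 1) * g (k + 1) with hSdef
  have hS0 : ∀ k, 0 < S k := fun k => mul_pos (hw _) (hg0 k)
  have hSq : ∀ k, S k ≤ K * C * q k := by
    intro k
    calc w (k + 1) * g (k + 1) ≤ (K * c k) * (C * (q k)⁻¹) :=
          mul_le_mul (hK k) (hgC k) (hg0 k).le (by have := hc k; positivity)
      _ = K * C * q k := by
          rw [← hqq k]
          have := (hq k).ne'
          field_simp
  have hqs := summable_of_geometric hq hs0 hs1 hqL
  have hSs : Summable S :=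
    Summable.of_nonneg_of_le (fun k => (hS0 k).le) hSq (hqs.mul_left (K * C))
  set T : ℕ → ℝ := fun k => ∑' j, S (j + k) with hTdef
  have hTs : ∀ k, Summable fun j => S (j + k) := fun k => (summable_nat_add_iff k).2 hSs
  have hTrec : ∀ k, T k = S k + T (k + 1) := by
    intro k
    have := (hTs k).tsum_eq_zero_add
    simp only [hTdef]
    rw [this, zero_add]
    congr 2
    ext j
    congr 1
    ring
  have hT0 : ∀ k, 0 ≤ T k := fun k => tsum_nonneg fun j => (hS0 _).le
  have hTq : ∀ k, T k ≤ K * C * C * q k := by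
    intro k
    have h1 : T k ≤ ∑' j, K * C * q (j + k) :=
      (hTs k).tsum_le_tsum (fun j => hSq _) (((summable_nat_add_iff k).2 hqs).mul_left _)
    rw [tsum_mul_left] at h1
    have h2 := tsum_tail_le_of_geometric hq hs0 hs1 hqL k
    calc T k ≤ K * C * ∑' j, q (j + k) := h1
      _ ≤ K * C * (C * q k) := by gcongr
      _ = _ := by ring
  -- If `h` has increments `f`, then `c * f = T` is its flux across each edge, and `T k - T (k + 1)
  -- = w (k + 1) * g (k + 1)` says that the generator sends `h` to `-g` away from 0. Differencing
  -- once more, the operator on increments sends `f` to `f - 1 / q`.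
  set f : ℕ → ℝ := fun k => T k / c k with hfdef
  have hfq : ∀ k, f k ≤ K * C * C * (q k)⁻¹ := by
    intro k
    rw [hfdef]
    simp only
    rw [div_le_iff₀ (hc k), ← hqq k]
    have := (hq k).ne'
    have e : K * C * C * (q k)⁻¹ * (q k * q k) = K * C * C * q k := by field_simp
    rw [e]
    exact hTq k
  have hd0 : ∀ k, 0 < d k := fun k => by
    have := hwd k
    have h2 := hc k
    have h3 := hw (k + 1)
    rw [← this] at h2
    exact pos_of_mul_pos_right h2 h3.le
  have hu0 : ∀ k, 0 < u k := fun k => by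
    have := hwu k
    have h2 := hc k
    have h3 := hw k
    rw [← this] at h2
    exact pos_of_mul_pos_right h2 h3.le
  -- Since `f ≤ K * C * C / q`, subtracting `1 / q` removes at least the fraction `1 / R` of `f`.
  -- The added 1 makes `R > 1`, so the rate `1 - 1 / R` is positive.
  set R : ℝ := K * C * C + 1 with hR
  have hR1 : 1 < R := by
    have : 0 < K * C * C := by positivity
    linarith
  have hf0 : ∀ k, 0 ≤ f k := fun k => div_nonneg (hT0 k) (hc k).le
  have hfR : ∀ k, f k - (q k)⁻¹ ≤ (1 - R⁻¹) * f k := by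
    intro k
    have h1 : R⁻¹ * f k ≤ (q k)⁻¹ := by
      rw [inv_mul_le_iff₀ (by linarith)]
      have := inv_pos.2 (hq k)
      nlinarith [hfq k]
    linarith
  have huf : ∀ k, u k * f k = T k / w k := by
    intro k
    have h1 := (hw k).ne'
    have h2 := (hu0 k).ne'
    simp only [hfdef]
    rw [← hwu k]
    field_simp
  have hdf : ∀ k, d k * f k = T k / w (k + 1) := by
    intro k
    have h1 := (hw (k + 1)).ne'
    have h2 := (hd0 k).ne'
    simp only [hfdef]
    rw [← hwd k]
    field_simp
  have hSw : ∀ k, T k / w (k + 1) - T (k + 1) / w (k + 1) = g (k + 1) := by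
    intro k
    rw [hTrec k]
    have h1 := (hw (k + 1)).ne'
    simp only [hSdef]
    field_simp
    ring
  have hgs : ∀ k, g (k + 1) = g k + (q k)⁻¹ := fun k => Finset.sum_range_succ _ _
  refine ⟨f, 1 - R⁻¹, (q 0)⁻¹, ?_, ?_, inv_pos.2 (hq 0), ?_, ?_, ?_, ?_⟩
  · have := inv_lt_one_of_one_lt₀ hR1
    linarith
  · have : 0 < R⁻¹ := inv_pos.2 (by linarith)
    linarith
  · intro k
    refine (hgpos k).trans ?_
    have hcw : c k ≤ w (k + 1) := by
      rw [← hwd k]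
      have := hud k
      have := hu0 k
      nlinarith [hw (k + 1)]
    simp only [hfdef]
    rw [le_div_iff₀ (hc k)]
    calc g (k + 1) * c k ≤ g (k + 1) * w (k + 1) := by
          have := (hg0 k).le
          gcongr
      _ = S k := mul_comm _ _
      _ ≤ T k := by
          rw [hTrec k]
          linarith [hT0 (k + 1)]
  -- The partial sums of `f` are of the same order as `g`, so this series is dominated by the
  -- summable `S`.
  · rw [← summable_nat_add_iff 1]
    refine Summable.of_nonneg_of_le (fun k => ?_) (fun k => ?_) (hSs.mul_left (K * C * C))
    · exact mul_nonneg (hw _).le (Finset.sum_nonneg fun i _ => hf0 i)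
    · have : ∑ i ∈ Finset.range (k + 1), f i ≤ K * C * C * g (k + 1) := by
        simp only [hgdef]
        rw [Finset.mul_sum]
        exact Finset.sum_le_sum fun i _ => hfq i
      calc w (k + 1) * ∑ i ∈ Finset.range (k + 1), f i
          ≤ w (k + 1) * (K * C * C * g (k + 1)) := by
            have := (hw (k + 1)).le
            gcongr
        _ = K * C * C * S k := by
            simp only [hSdef]
            ring
  -- At the boundary there is no inflow from below; the unmatched term `-T 0 / w 0` has the
  -- favourable sign and is dropped.
  · have h1 := hfR 0
    have h2 := huf 0
    have h3 := hdf 0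
    have h4 := huf 1
    have h5 := hSw 0
    have h6 := hgs 0
    have h7 : g 0 = 0 := by simp [hgdef]
    have h8 : 0 ≤ T 0 / w 0 := div_nonneg (hT0 0) (hw 0).le
    simp only [zero_add] at h3 h5 h6
    linarith
  · intro k
    have h1 := hfR (k + 1)
    have h2 := huf (k + 1)
    have h3 := hdf (k + 1)
    have h4 := huf (k + 2)
    have h5 := hSw (k + 1)
    have h6 := hgs (k + 1)
    have h7 := hdf k
    have h8 := hSw k
    simp only [add_assoc, Nat.reduceAdd] at *
    linarith

/-- Uniform geometric convergence for iterates `G n` of a function under a monotone birth and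
death chain whose conductances decay geometrically up to a constant. -/
theorem birthDeath_convergence {u d w c : ℕ → ℝ} (hw : ∀ k, 0 < w k) (hc : ∀ k, 0 < c k)
    (hwu : ∀ k, w k * u k = c k) (hwd : ∀ k, w (k + 1) * d k = c k)
    (hud : ∀ k, u k + d k ≤ 1) {K L r : ℝ} (hr0 : 0 < r) (hr1 : r < 1)
    (hK : ∀ k, w (k + 1) ≤ K * c k) (hL : ∀ k j, c (k + j) ≤ L * r ^ j * c k)
    (hw1 : HasSum w 1) :
    ∃ (B : ℕ → ℝ) (t : ℝ), 0 < t ∧ t < 1 ∧ ∀ G : ℕ → ℕ → ℝ, (∀ n k, |G n k| ≤ 1) →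
      (∀ n, G (n + 1) 0 = G n 0 + u 0 * (G n 1 - G n 0)) →
      (∀ n k, G (n + 1) (k + 1) = G n (k + 1) + u (k + 1) * (G n (k + 2) - G n (k + 1))
        - d k * (G n (k + 1) - G n k)) →
      ∀ n k, |G n k - ∑' j, w j * G n j| ≤ B k * t ^ n := by
  obtain ⟨f, t, δ, ht0, ht1, hδ, hδf, hfs, hf0, hfk⟩ :=
    exists_contracting_weight hw hc hwu hwd hud hr0 hr1 hK hL
  have hd0 : ∀ k, 0 ≤ d k := fun k => by
    have h2 := hc k
    rw [← hwd k] at h2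
    exact (pos_of_mul_pos_right h2 (hw _).le).le
  have hu0 : ∀ k, 0 ≤ u k := fun k => by
    have h2 := hc k
    rw [← hwu k] at h2
    exact (pos_of_mul_pos_right h2 (hw _).le).le
  set F : ℕ → ℝ := fun k => ∑ i ∈ Finset.range k, f i with hF
  -- Initial increments are at most 2, hence at most `2 / δ * f`. `F k + F j` then bounds the
  -- weighted distance between two states, and averaging `j` over `w` gives the constant.
  refine ⟨fun k => 2 / δ * (F k + ∑' j, w j * F j), t, ht0, ht1, ?_⟩
  intro G hG hG0 hGk n k
  have hD : ∀ n k, |G n (k + 1) - G n k| ≤ 2 / δ * t ^ n * f k := by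
    intro n
    induction n with
    | zero =>
      intro k
      have h1 : |G 0 (k + 1) - G 0 k| ≤ 2 := by
        have h1 := abs_le.1 (hG 0 (k + 1))
        have h2 := abs_le.1 (hG 0 k)
        rw [abs_le]
        constructor <;> linarith
      have h2 : 2 ≤ 2 / δ * f k := by
        rw [div_mul_eq_mul_div, le_div_iff₀ hδ]
        linarith [hδf k]
      simpa using h1.trans h2
    | succ n ih =>
      intro k
      set E := 2 / δ * t ^ n with hE
      have hE0 : 0 ≤ E := by positivity
      rcases k with _ | k
      · have e : G (n + 1) (0 + 1) - G (n + 1) 0 = (1 - u 0 - d 0) * (G n (0 + 1) - G n 0)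
            + u 1 * (G n (1 + 1) - G n 1) := by
          rw [hGk n 0, hG0 n]
          simp only [zero_add, Nat.reduceAdd]
          ring
        have h0 := ih 0
        have h1 := ih 1
        have p1 : 0 ≤ 1 - u 0 - d 0 := by linarith [hud 0]
        rw [e]
        calc _ ≤ |(1 - u 0 - d 0) * (G n (0 + 1) - G n 0)| + |u 1 * (G n (1 + 1) - G n 1)| :=
              abs_add_le _ _
          _ = (1 - u 0 - d 0) * |G n (0 + 1) - G n 0| + u 1 * |G n (1 + 1) - G n 1| := by
              rw [abs_mul, abs_mul, abs_of_nonneg p1, abs_of_nonneg (hu0 1)]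
          _ ≤ (1 - u 0 - d 0) * (E * f 0) + u 1 * (E * f 1) :=
              add_le_add (mul_le_mul_of_nonneg_left h0 p1)
                (mul_le_mul_of_nonneg_left h1 (hu0 1))
          _ = E * ((1 - u 0 - d 0) * f 0 + u 1 * f 1) := by ring
          _ ≤ E * (t * f 0) := mul_le_mul_of_nonneg_left hf0 hE0
          _ = _ := by rw [hE]; ring
      · have e : G (n + 1) (k + 1 + 1) - G (n + 1) (k + 1)
            = (1 - u (k + 1) - d (k + 1)) * (G n (k + 1 + 1) - G n (k + 1))
            + u (k + 2) * (G n (k + 2 + 1) - G n (k + 2)) + d k * (G n (k + 1) - G n k) := by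
          rw [hGk n (k + 1), hGk n k]
          simp only [add_assoc, Nat.reduceAdd]
          ring
        have h0 := ih k
        have h1 := ih (k + 1)
        have h2 := ih (k + 2)
        have p1 : 0 ≤ 1 - u (k + 1) - d (k + 1) := by linarith [hud (k + 1)]
        rw [e]
        calc _ ≤ |(1 - u (k + 1) - d (k + 1)) * (G n (k + 1 + 1) - G n (k + 1))|
              + |u (k + 2) * (G n (k + 2 + 1) - G n (k + 2))| + |d k * (G n (k + 1) - G n k)| :=
              abs_add_three _ _ _
          _ = (1 - u (k + 1) - d (k + 1)) * |G n (k + 1 + 1) - G n (k + 1)|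
              + u (k + 2) * |G n (k + 2 + 1) - G n (k + 2)| + d k * |G n (k + 1) - G n k| := by
              rw [abs_mul, abs_mul, abs_mul, abs_of_nonneg p1, abs_of_nonneg (hu0 _),
                abs_of_nonneg (hd0 _)]
          _ ≤ (1 - u (k + 1) - d (k + 1)) * (E * f (k + 1))
              + u (k + 2) * (E * f (k + 2)) + d k * (E * f k) :=
              add_le_add (add_le_add (mul_le_mul_of_nonneg_left h1 p1)
                (mul_le_mul_of_nonneg_left h2 (hu0 _))) (mul_le_mul_of_nonneg_left h0 (hd0 _))
          _ = E * ((1 - u (k + 1) - d (k + 1)) * f (k + 1) + u (k + 2) * f (k + 2)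
              + d k * f k) := by ring
          _ ≤ E * (t * f (k + 1)) := mul_le_mul_of_nonneg_left (hfk k) hE0
          _ = _ := by rw [hE]; ring
  set E := 2 / δ * t ^ n with hE
  have hE0 : 0 ≤ E := by positivity
  have hF0 : ∀ j, 0 ≤ F j := fun j => Finset.sum_nonneg fun i _ => hδ.le.trans (hδf i)
  have hGF : ∀ j, |G n j - G n 0| ≤ E * F j := by
    intro j
    rw [← Finset.sum_range_sub, hF]
    simp only
    rw [Finset.mul_sum]
    exact (Finset.abs_sum_le_sum_abs _ _).trans (Finset.sum_le_sum fun i _ => hD n i)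
  have hGG : ∀ j, |G n k - G n j| ≤ E * (F k + F j) := by
    intro j
    have h1 := hGF k
    have h2 := hGF j
    calc |G n k - G n j| = |(G n k - G n 0) - (G n j - G n 0)| := by ring_nf
      _ ≤ |G n k - G n 0| + |G n j - G n 0| := abs_sub _ _
      _ ≤ _ := by rw [mul_add]; linarith
  have hwG : Summable fun j => w j * G n j := by
    refine Summable.of_norm_bounded hw1.summable fun j => ?_
    rw [Real.norm_eq_abs, abs_mul, abs_of_pos (hw j)]
    exact mul_le_of_le_one_right (hw j).le (hG n j)
  have e1 : G n k = ∑' j, w j * G n k := by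
    rw [tsum_mul_right, hw1.tsum_eq, one_mul]
  have hs1 : Summable fun j => w j * G n k := hw1.summable.mul_right _
  have hbs : Summable fun j => E * (w j * F k + w j * F j) :=
    ((hw1.summable.mul_right _).add hfs).mul_left _
  have hb : ∀ j, |w j * G n k - w j * G n j| ≤ E * (w j * F k + w j * F j) := by
    intro j
    rw [← mul_sub, abs_mul, abs_of_pos (hw j)]
    calc w j * |G n k - G n j| ≤ w j * (E * (F k + F j)) :=
          mul_le_mul_of_nonneg_left (hGG j) (hw j).le
      _ = _ := by ring
  calc |G n k - ∑' j, w j * G n j| = |∑' j, (w j * G n k - w j * G n j)| := by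
        rw [hs1.tsum_sub hwG, ← e1]
    _ ≤ ∑' j, E * (w j * F k + w j * F j) := by
        rw [← Real.norm_eq_abs]
        exact tsum_of_norm_bounded hbs.hasSum hb
    _ = E * (F k + ∑' j, w j * F j) := by
        rw [tsum_mul_left, (hw1.summable.mul_right _).tsum_add hfs, tsum_mul_right,
          hw1.tsum_eq, one_mul]
    _ = _ := by rw [hE]; ring

/-! ### Total variation and iterated kernels -/

section General

variable {Z : Type*} [MeasurableSpace Z]

/-- The Hahn decomposition splits the total variation into the discrepancies on one set and on its
complement, whence the factor 2. -/
theorem tvNorm_le_of_forall_set {μ ν : Measure Z} [IsFiniteMeasure μ] [IsFiniteMeasure ν] {ε : ℝ}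
    (h : ∀ S, MeasurableSet S → |μ.real S - ν.real S| ≤ ε) :
    tvNorm μ ν ≤ ENNReal.ofReal (2 * ε) := by
  obtain ⟨i, hi₁, hi₂, hi₃, hp, hn⟩ :=
    (μ.toSignedMeasure - ν.toSignedMeasure).toJordanDecomposition_spec
  have h1 := (le_abs_self _).trans (h i hi₁)
  have h2 := (neg_le_abs _).trans (h iᶜ hi₁.compl)
  have hε : 0 ≤ ε := (abs_nonneg _).trans (h i hi₁)
  rw [tvNorm, SignedMeasure.totalVariation, hp, hn, Measure.add_apply, two_mul,
    ENNReal.ofReal_add hε hε]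
  refine add_le_add ?_ ?_
  · rw [← ofReal_measureReal, SignedMeasure.toMeasureOfZeroLE_real_apply _ hi₂ hi₁ .univ,
      Set.inter_univ, Measure.toSignedMeasure_sub_apply hi₁]
    exact ENNReal.ofReal_le_ofReal h1
  · rw [← ofReal_measureReal, SignedMeasure.toMeasureOfLEZero_real_apply _ hi₃ hi₁.compl .univ,
      Set.inter_univ, Measure.toSignedMeasure_sub_apply hi₁.compl]
    exact ENNReal.ofReal_le_ofReal h2

theorem GeometricallyErgodic.of_forall_set {P : Kernel Z Z} {w : Measure Z} [IsMarkovKernel P]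
    [IsProbabilityMeasure w] (hinv : Kernel.Invariant P w) {B : Z → ℝ} {t : ℝ} (ht0 : 0 < t)
    (ht1 : t < 1)
    (h : ∀ S, MeasurableSet S → ∀ z n, |(nStep P n z).real S - w.real S| ≤ B z * t ^ n) :
    GeometricallyErgodic P w := by
  refine ⟨inferInstance, inferInstance, hinv, fun z => 2 * B z, t, ht0, ht1, fun z n => ?_⟩
  rw [mul_assoc]
  exact tvNorm_le_of_forall_set fun S hS => h S hS z n

/-- Peeling off the first step instead of the last gives the backward recursion for `z ↦ P ^ n (z,
S)`, the form in which the birth and death estimates apply. -/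
theorem nStep_succ' (P : Kernel Z Z) (n : ℕ) : nStep P (n + 1) = nStep P n ∘ₖ P := by
  induction n with
  | zero => simp [nStep]
  | succ n ih =>
    rw [nStep, ih, ← Kernel.comp_assoc, ← nStep, ih]

theorem nStep_succ_apply (P : Kernel Z Z) (n : ℕ) (z : Z) {S : Set Z} (hS : MeasurableSet S) :
    nStep P (n + 1) z S = ∫⁻ z', nStep P n z' S ∂P z := by
  rw [nStep_succ', Kernel.comp_apply' _ _ _ hS]

theorem invariant_nStep {P : Kernel Z Z} {w : Measure Z} (h : Kernel.Invariant P w) (n : ℕ) :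
    Kernel.Invariant (nStep P n) w := by
  induction n with
  | zero => simp [nStep, Kernel.Invariant]
  | succ n ih => exact h.comp ih

theorem lintegral_nStep {P : Kernel Z Z} {w : Measure Z} (h : Kernel.Invariant P w) (n : ℕ)
    {S : Set Z} (hS : MeasurableSet S) : ∫⁻ z, nStep P n z S ∂w = w S := by
  have := congrArg (fun μ => μ S) (invariant_nStep h n).def
  rwa [Measure.bind_apply hS (Kernel.aemeasurable _)] at this

theorem abs_real_sub_real_le_one (μ ν : Measure Z) [IsProbabilityMeasure μ]
    [IsProbabilityMeasure ν] (S : Set Z) : |μ.real S - ν.real S| ≤ 1 := by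
  have h1 : μ.real S ≤ 1 := measureReal_le_one
  have h2 : ν.real S ≤ 1 := measureReal_le_one
  have h3 : 0 ≤ μ.real S := measureReal_nonneg
  have h4 : 0 ≤ ν.real S := measureReal_nonneg
  rw [abs_le]
  constructor <;> linarith

theorem isMarkovKernel_of_lintegral_one {P : Kernel Z Z} (h : ∀ z, ∫⁻ _, 1 ∂P z = 1) :
    IsMarkovKernel P :=
  ⟨fun z => ⟨by simpa using h z⟩⟩

theorem invariant_of_lintegral {P : Kernel Z Z} {w : Measure Z}
    (h : ∀ g : Z → ℝ≥0∞, ∫⁻ z, ∫⁻ z', g z' ∂P z ∂w = ∫⁻ z, g z ∂w) : Kernel.Invariant P w := by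
  ext S hS
  rw [Measure.bind_apply hS (Kernel.aemeasurable _)]
  simpa [lintegral_indicator_one hS] using h (S.indicator 1)

variable [Countable Z] [MeasurableSingletonClass Z]

theorem lintegral_measureOfDensity (f : Z → ℝ) (g : Z → ℝ≥0∞) :
    ∫⁻ z, g z ∂measureOfDensity f = ∑' z, ENNReal.ofReal (f z) * g z := by
  rw [measureOfDensity, lintegral_withDensity_eq_lintegral_mul _ .of_discrete .of_discrete,
    lintegral_count]
  rfl

theorem lintegral_kernelOfDensity (k : Z → Z → ℝ) (z : Z) (g : Z → ℝ≥0∞) :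
    ∫⁻ z', g z' ∂kernelOfDensity k z = ∑' z', ENNReal.ofReal (k z z') * g z' :=
  lintegral_measureOfDensity _ _

end General

/-! ### Gibbs samplers for a general density -/

section Gibbs

variable {π : ℕ+ → ℕ+ → ℝ}

theorem tsum_ofReal_left (h0 : ∀ x y, 0 ≤ π x y) (hs : ∀ y, Summable fun x => π x y) (y : ℕ+) :
    ∑' x, ENNReal.ofReal (π x y) = ENNReal.ofReal (margY π y) :=
  (ENNReal.ofReal_tsum_of_nonneg (fun x => h0 x y) (hs y)).symm

theorem tsum_ofReal_right (h0 : ∀ x y, 0 ≤ π x y) (hs : ∀ x, Summable (π x)) (x : ℕ+) :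
    ∑' y, ENNReal.ofReal (π x y) = ENNReal.ofReal (margX π x) :=
  (ENNReal.ofReal_tsum_of_nonneg (fun y => h0 x y) (hs x)).symm

theorem ofReal_margY_mul_condX {y : ℕ+} (hY : 0 < margY π y) (x : ℕ+) :
    ENNReal.ofReal (margY π y) * ENNReal.ofReal (condX π x y) = ENNReal.ofReal (π x y) := by
  rw [← ENNReal.ofReal_mul hY.le, condX, mul_div_cancel₀ _ hY.ne']

theorem ofReal_margX_mul_condY {x : ℕ+} (hX : 0 < margX π x) (y : ℕ+) :
    ENNReal.ofReal (margX π x) * ENNReal.ofReal (condY π y x) = ENNReal.ofReal (π x y) := by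
  rw [← ENNReal.ofReal_mul hX.le, condY, mul_div_cancel₀ _ hX.ne']

/-- A nonnegative density with positive marginals. -/
structure IsGibbsDensity (π : ℕ+ → ℕ+ → ℝ) : Prop where
  nonneg : ∀ x y, 0 ≤ π x y
  summable_left : ∀ y, Summable fun x => π x y
  summable_right : ∀ x, Summable (π x)
  margX_pos : ∀ x, 0 < margX π x
  margY_pos : ∀ y, 0 < margY π y

namespace IsGibbsDensity

variable (h : IsGibbsDensity π)
include h

theorem condX_nonneg (x y : ℕ+) : 0 ≤ condX π x y := div_nonneg (h.nonneg x y) (h.margY_pos y).le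

theorem condY_nonneg (y x : ℕ+) : 0 ≤ condY π y x := div_nonneg (h.nonneg x y) (h.margX_pos x).le

theorem tsum_condX (y : ℕ+) : ∑' x, ENNReal.ofReal (condX π x y) = 1 := by
  have h1 : ENNReal.ofReal (margY π y) * ∑' x, ENNReal.ofReal (condX π x y)
      = ENNReal.ofReal (margY π y) * 1 := by
    rw [← ENNReal.tsum_mul_left, mul_one]
    refine Eq.trans ?_ (tsum_ofReal_left h.nonneg h.summable_left y)
    exact tsum_congr fun x => ofReal_margY_mul_condX (h.margY_pos y) x
  exact (ENNReal.mul_right_inj (by simpa using h.margY_pos y) ENNReal.ofReal_ne_top).1 h1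

theorem tsum_condY (x : ℕ+) : ∑' y, ENNReal.ofReal (condY π y x) = 1 := by
  have h1 : ENNReal.ofReal (margX π x) * ∑' y, ENNReal.ofReal (condY π y x)
      = ENNReal.ofReal (margX π x) * 1 := by
    rw [← ENNReal.tsum_mul_left, mul_one]
    refine Eq.trans ?_ (tsum_ofReal_right h.nonneg h.summable_right x)
    exact tsum_congr fun y => ofReal_margX_mul_condY (h.margX_pos x) y
  exact (ENNReal.mul_right_inj (by simpa using h.margX_pos x) ENNReal.ofReal_ne_top).1 h1

theorem condX_le_one (x y : ℕ+) : condX π x y ≤ 1 := by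
  rw [condX, div_le_one (h.margY_pos y)]
  exact (h.summable_left y).le_tsum x fun x' _ => h.nonneg x' y

theorem summable_condX_mul_condY (x' x : ℕ+) :
    Summable fun y => condX π x' y * condY π y x := by
  have hs : Summable fun y => condY π y x := (h.summable_right x).div_const _
  refine Summable.of_nonneg_of_le
    (fun y => mul_nonneg (h.condX_nonneg _ _) (h.condY_nonneg _ _)) (fun y => ?_) hs
  exact mul_le_of_le_one_left (h.condY_nonneg _ _) (h.condX_le_one _ _)

/-- Tonelli turns the kernel into two successive conditional updates, `y` given `x` and then `x'`
given `y`. -/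
theorem lintegral_kernelX (x : ℕ+) (g : ℕ+ → ℝ≥0∞) :
    ∫⁻ x', g x' ∂kernelX π x = ∑' y, ENNReal.ofReal (condY π y x) *
      ∑' x', ENNReal.ofReal (condX π x' y) * g x' := by
  rw [kernelX, lintegral_kernelOfDensity]
  simp_rw [← ENNReal.tsum_mul_left]
  rw [ENNReal.tsum_comm]
  refine tsum_congr fun x' => ?_
  rw [ENNReal.ofReal_tsum_of_nonneg
    (fun y => mul_nonneg (h.condX_nonneg _ _) (h.condY_nonneg _ _))
    (h.summable_condX_mul_condY x' x), ← ENNReal.tsum_mul_right]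
  refine tsum_congr fun y => ?_
  rw [ENNReal.ofReal_mul (h.condX_nonneg _ _)]
  ring

theorem lintegral_kernelDGS (z : ℕ+ × ℕ+) (g : ℕ+ × ℕ+ → ℝ≥0∞) :
    ∫⁻ z', g z' ∂kernelDGS π z = ∑' x', ENNReal.ofReal (condX π x' z.2) *
      ∑' y', ENNReal.ofReal (condY π y' x') * g (x', y') := by
  rw [kernelDGS, lintegral_kernelOfDensity, ENNReal.tsum_prod']
  simp_rw [← ENNReal.tsum_mul_left]
  refine tsum_congr fun x' => tsum_congr fun y' => ?_
  rw [ENNReal.ofReal_mul (h.condX_nonneg _ _)]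
  ring

theorem lintegral_kernelRGS {p : ℝ} (hp0 : 0 ≤ p) (hp1 : p ≤ 1) (z : ℕ+ × ℕ+)
    (g : ℕ+ × ℕ+ → ℝ≥0∞) :
    ∫⁻ z', g z' ∂kernelRGS π p z
      = ENNReal.ofReal p * ∑' x', ENNReal.ofReal (condX π x' z.2) * g (x', z.2)
        + ENNReal.ofReal (1 - p) * ∑' y', ENNReal.ofReal (condY π y' z.1) * g (z.1, y') := by
  have hp1' : 0 ≤ 1 - p := by linarith
  rw [kernelRGS, lintegral_kernelOfDensity]
  have e : ∀ z' : ℕ+ × ℕ+, ENNReal.ofReal (p * condX π z'.1 z.2 * (if z'.2 = z.2 then 1 else 0)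
      + (1 - p) * condY π z'.2 z.1 * (if z'.1 = z.1 then 1 else 0)) * g z'
      = ENNReal.ofReal p * (ENNReal.ofReal (condX π z'.1 z.2) *
          (if z'.2 = z.2 then g z' else 0))
        + ENNReal.ofReal (1 - p) * (ENNReal.ofReal (condY π z'.2 z.1) *
          (if z'.1 = z.1 then g z' else 0)) := by
    intro z'
    have h1 := h.condX_nonneg z'.1 z.2
    have h2 := h.condY_nonneg z'.2 z.1
    rw [ENNReal.ofReal_add (by positivity) (by positivity), add_mul]
    congr 1
    · split_ifs
      · rw [mul_one, ENNReal.ofReal_mul hp0, mul_assoc]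
      · simp
    · split_ifs
      · rw [mul_one, ENNReal.ofReal_mul hp1', mul_assoc]
      · simp
  rw [tsum_congr e, ENNReal.tsum_add, ENNReal.tsum_mul_left, ENNReal.tsum_mul_left]
  congr 2
  · rw [ENNReal.tsum_prod']
    refine tsum_congr fun x' => ?_
    rw [tsum_eq_single z.2]
    · simp
    · intro y' hy
      simp [hy]
  · rw [ENNReal.tsum_prod', ENNReal.tsum_comm]
    refine tsum_congr fun y' => ?_
    rw [tsum_eq_single z.1]
    · simp
    · intro x' hx
      simp [hx]

/-- This disintegration and its counterpart over `Y` are all that invariance needs: each conditional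
update undoes one of them. -/
theorem lintegral_target_eq_X (g : ℕ+ × ℕ+ → ℝ≥0∞) :
    ∫⁻ z, g z ∂target π = ∑' x, ENNReal.ofReal (margX π x) *
      ∑' y, ENNReal.ofReal (condY π y x) * g (x, y) := by
  rw [target, lintegral_measureOfDensity, ENNReal.tsum_prod']
  simp_rw [← ENNReal.tsum_mul_left, ← mul_assoc]
  refine tsum_congr fun x => tsum_congr fun y => ?_
  rw [ofReal_margX_mul_condY (h.margX_pos x)]

theorem lintegral_target_eq_Y (g : ℕ+ × ℕ+ → ℝ≥0∞) :
    ∫⁻ z, g z ∂target π = ∑' y, ENNReal.ofReal (margY π y) *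
      ∑' x, ENNReal.ofReal (condX π x y) * g (x, y) := by
  rw [target, lintegral_measureOfDensity, ENNReal.tsum_prod', ENNReal.tsum_comm]
  simp_rw [← ENNReal.tsum_mul_left, ← mul_assoc]
  refine tsum_congr fun y => tsum_congr fun x => ?_
  rw [ofReal_margY_mul_condX (h.margY_pos y)]

theorem lintegral_target_fst (g : ℕ+ → ℝ≥0∞) :
    ∫⁻ z, g z.1 ∂target π = ∑' x, ENNReal.ofReal (margX π x) * g x := by
  rw [h.lintegral_target_eq_X]
  simp [ENNReal.tsum_mul_right, h.tsum_condY]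

theorem lintegral_target_snd (g : ℕ+ → ℝ≥0∞) :
    ∫⁻ z, g z.2 ∂target π = ∑' y, ENNReal.ofReal (margY π y) * g y := by
  rw [h.lintegral_target_eq_Y]
  simp [ENNReal.tsum_mul_right, h.tsum_condX]

theorem isMarkovKernel_kernelX : IsMarkovKernel (kernelX π) :=
  isMarkovKernel_of_lintegral_one fun x => by
    simp [h.lintegral_kernelX, h.tsum_condX, h.tsum_condY]

theorem isMarkovKernel_kernelDGS : IsMarkovKernel (kernelDGS π) :=
  isMarkovKernel_of_lintegral_one fun x => by
    simp [h.lintegral_kernelDGS, h.tsum_condX, h.tsum_condY]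

theorem isMarkovKernel_kernelRGS {p : ℝ} (hp0 : 0 ≤ p) (hp1 : p ≤ 1) :
    IsMarkovKernel (kernelRGS π p) :=
  isMarkovKernel_of_lintegral_one fun x => by
    rw [h.lintegral_kernelRGS hp0 hp1]
    simp only [mul_one, h.tsum_condX, h.tsum_condY]
    rw [← ENNReal.ofReal_add hp0 (by linarith)]
    simp

theorem invariant_kernelX : Kernel.Invariant (kernelX π) (targetX π) :=
  invariant_of_lintegral fun g => by
    simp_rw [h.lintegral_kernelX]
    rw [targetX, lintegral_measureOfDensity, lintegral_measureOfDensity,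
      ← h.lintegral_target_eq_X
        (fun z => ∑' x', ENNReal.ofReal (condX π x' z.2) * g x'),
      h.lintegral_target_snd (fun y => ∑' x', ENNReal.ofReal (condX π x' y) * g x'),
      ← h.lintegral_target_eq_Y (fun z => g z.1), h.lintegral_target_fst]

theorem invariant_kernelDGS : Kernel.Invariant (kernelDGS π) (target π) :=
  invariant_of_lintegral fun g => by
    simp_rw [h.lintegral_kernelDGS]
    rw [h.lintegral_target_snd (fun y => ∑' x', ENNReal.ofReal (condX π x' y) *
        ∑' y', ENNReal.ofReal (condY π y' x') * g (x', y')),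
      ← h.lintegral_target_eq_Y (fun z => ∑' y', ENNReal.ofReal (condY π y' z.1) * g (z.1, y')),
      h.lintegral_target_fst (fun x => ∑' y', ENNReal.ofReal (condY π y' x) * g (x, y')),
      ← h.lintegral_target_eq_X]

theorem invariant_kernelRGS {p : ℝ} (hp0 : 0 ≤ p) (hp1 : p ≤ 1) :
    Kernel.Invariant (kernelRGS π p) (target π) :=
  invariant_of_lintegral fun g => by
    simp_rw [h.lintegral_kernelRGS hp0 hp1]
    rw [lintegral_add_left .of_discrete, lintegral_const_mul _ .of_discrete,
      lintegral_const_mul _ .of_discrete,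
      h.lintegral_target_snd (fun y => ∑' x', ENNReal.ofReal (condX π x' y) * g (x', y)),
      ← h.lintegral_target_eq_Y,
      h.lintegral_target_fst (fun x => ∑' y', ENNReal.ofReal (condY π y' x) * g (x, y')),
      ← h.lintegral_target_eq_X, ← add_mul, ← ENNReal.ofReal_add hp0 (by linarith)]
    simp

end IsGibbsDensity

end Gibbs

/-! ### Consequences of the growth conditions -/

/-- The finitely many terms before the eventual bound sets in are absorbed into the constant. -/
theorem exists_forall_le_of_limsupENN_lt_top {u : ℕ+ → ℝ} (h : limsupENN u < ⊤) :
    ∃ C, 0 < C ∧ ∀ k : ℕ, u k.succPNat ≤ C := by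
  obtain ⟨c, hc, -⟩ := ENNReal.lt_iff_exists_nnreal_btwn.1 h
  have h1 : ∀ᶠ i in atTop, u i ≤ c := by
    filter_upwards [eventually_lt_of_limsup_lt hc] with i hi
    by_contra! hlt
    refine absurd hi (not_lt.2 ?_)
    rw [← ENNReal.ofReal_coe_nnreal]
    exact ENNReal.ofReal_le_ofReal hlt.le
  obtain ⟨N, hN⟩ := eventually_atTop.1 h1
  refine ⟨c + ∑ k ∈ Finset.range N, |u k.succPNat| + 1, by positivity, fun k => ?_⟩
  have hs : 0 ≤ ∑ k ∈ Finset.range N, |u k.succPNat| := Finset.sum_nonneg fun _ _ => abs_nonneg _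
  by_cases hk : k < N
  · have := Finset.single_le_sum (f := fun k : ℕ => |u k.succPNat|) (fun _ _ => abs_nonneg _)
      (Finset.mem_range.2 hk)
    have h2 := le_abs_self (u k.succPNat)
    linarith [c.coe_nonneg]
  · have := hN k.succPNat (by
      rw [← PNat.coe_le_coe, Nat.succPNat_coe]
      omega)
    linarith

/-- The growth conditions force `a` to decay eventually geometrically. -/
theorem exists_eventually_ratio_le {a b : ℕ+ → ℝ} (ha : ∀ i, 0 < a i) (hb : ∀ i, 0 < b i)
    {C : ℝ} (hC0 : 0 < C) (hC : ∀ᶠ i in atTop, a (i + 1) ≤ C * b i) {A m M : ℝ≥0∞}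
    (hA : A = limsupENN (fun i => a (i + 1) / a i))
    (hm : m = liminfENN (fun i => a i / b i)) (hM : M = limsupENN (fun i => a i / b i))
    (hAMm : A * (1 + M) / (1 + m) < 1) :
    ∃ ρ : ℝ, 0 < ρ ∧ ρ < 1 ∧ ∀ᶠ i in atTop, a (i + 1) ≤ ρ * a i := by
  have hmM : m ≤ M := by
    rw [hm, hM]
    exact liminf_le_limsup
  -- In this case the product condition may hold only by convention (`∞ / ∞ = 0` in `ℝ≥0∞`), so the
  -- decay comes from `a (i + 1) ≤ C * b i` with `2 * C * b i < a i` eventually.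
  by_cases hmt : m = ⊤
  · refine ⟨1 / 2, by norm_num, by norm_num, ?_⟩
    have h1 : ENNReal.ofReal (2 * C) < liminfENN (fun i => a i / b i) := by
      rw [← hm, hmt]
      exact ENNReal.ofReal_lt_top
    filter_upwards [hC, eventually_lt_of_lt_liminf h1] with i hi1 hi2
    have h2 := (ENNReal.ofReal_lt_ofReal_iff_of_nonneg (by positivity)).1 hi2
    rw [lt_div_iff₀ (hb i)] at h2
    linarith
  · have hA1 : A < 1 := by
      -- With `m` finite and `M` infinite, any nonzero `A` would make the quotient infinite.
      by_cases hMt : M = ⊤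
      · by_contra hA1
        have hA0 : A ≠ 0 := fun h => hA1 (by simp [h])
        rw [hMt, add_top, ENNReal.mul_top hA0, ENNReal.top_div_of_ne_top (by simp [hmt])] at hAMm
        exact absurd hAMm (by simp)
      · refine lt_of_le_of_lt ?_ hAMm
        rw [ENNReal.le_div_iff_mul_le (Or.inl (by simp)) (Or.inl (by simp [hmt]))]
        gcongr
    rw [hA] at hA1
    obtain ⟨c, hc, hc1⟩ := ENNReal.lt_iff_exists_nnreal_btwn.1 hA1
    have hc1' : (c : ℝ) < 1 := by exact_mod_cast hc1
    have hc0 : 0 < c := by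
      have := pos_of_gt hc
      exact_mod_cast this
    refine ⟨c, by exact_mod_cast hc0, hc1', ?_⟩
    filter_upwards [eventually_lt_of_limsup_lt hc] with i hi
    by_contra! hlt
    refine absurd hi (not_lt.2 ?_)
    rw [← ENNReal.ofReal_coe_nnreal]
    refine ENNReal.ofReal_le_ofReal ?_
    rw [le_div_iff₀ (ha i)]
    exact hlt.le

theorem exists_geometric_of_eventually {a : ℕ → ℝ} (ha : ∀ k, 0 < a k) {ρ : ℝ} (hρ : 0 < ρ)
    (h : ∀ᶠ k in atTop, a (k + 1) ≤ ρ * a k) :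
    ∃ K, 0 < K ∧ ∀ k j, a (k + j) ≤ K * ρ ^ j * a k := by
  obtain ⟨N, hN⟩ := eventually_atTop.1 h
  have h1 : ∀ k, N ≤ k → ∀ j, a (k + j) ≤ ρ ^ j * a k := by
    intro k hk j
    induction j with
    | zero => simp
    | succ j ih =>
      calc a (k + (j + 1)) ≤ ρ * a (k + j) := hN (k + j) (by omega)
        _ ≤ ρ * (ρ ^ j * a k) := by gcongr
        _ = _ := by ring
  -- After this normalisation the sequence is eventually nonincreasing, hence bounded by `H`. Only
  -- indices `k < N` need a constant larger than 1, and `H / b k` serves there.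
  set b : ℕ → ℝ := fun k => a k / ρ ^ k with hb
  have hb0 : ∀ k, 0 < b k := fun k => div_pos (ha k) (pow_pos hρ k)
  have hba : ∀ k j, b (k + j) * (ρ ^ j * ρ ^ k) = a (k + j) := by
    intro k j
    simp only [hb, pow_add]
    have := hρ.ne'
    field_simp
  have hba' : ∀ k, b k * ρ ^ k = a k := fun k => by simpa using hba k 0
  set H : ℝ := ∑ k ∈ Finset.range (N + 1), b k with hH
  have hH0 : 0 ≤ H := Finset.sum_nonneg fun k _ => (hb0 k).le
  have hbH : ∀ k, b k ≤ H := by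
    intro k
    by_cases hk : k < N + 1
    · exact Finset.single_le_sum (fun k _ => (hb0 k).le) (Finset.mem_range.2 hk)
    · have h2 := h1 N le_rfl (k - N)
      have e : N + (k - N) = k := by omega
      have h3 := hba N (k - N)
      rw [e] at h2 h3
      have h4 := Finset.single_le_sum (f := b) (s := Finset.range (N + 1)) (fun k _ => (hb0 k).le)
        (Finset.mem_range.2 (Nat.lt_succ_self N))
      refine le_trans ?_ h4
      rw [← h3, ← hba' N, mul_comm (b N), ← mul_assoc, mul_comm (b k)] at h2
      have h5 : 0 < ρ ^ (k - N) * ρ ^ N := by positivity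
      nlinarith
  set K : ℝ := 1 + ∑ k ∈ Finset.range N, H / b k with hK
  have hK1 : 1 ≤ K := by
    have : 0 ≤ ∑ k ∈ Finset.range N, H / b k :=
      Finset.sum_nonneg fun k _ => div_nonneg hH0 (hb0 k).le
    linarith
  refine ⟨K, by linarith, fun k j => ?_⟩
  by_cases hk : k < N
  · have h2 : H / b k ≤ K := by
      have := Finset.single_le_sum (f := fun k => H / b k)
        (fun k _ => div_nonneg hH0 (hb0 k).le) (Finset.mem_range.2 hk)
      linarith
    rw [div_le_iff₀ (hb0 k)] at h2
    calc a (k + j) = b (k + j) * (ρ ^ j * ρ ^ k) := (hba k j).symm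
      _ ≤ (K * b k) * (ρ ^ j * ρ ^ k) := by
        have := (hbH (k + j)).trans h2
        gcongr
      _ = K * ρ ^ j * (b k * ρ ^ k) := by ring
      _ = _ := by rw [hba']
  · have h2 := h1 k (by omega) j
    have h3 : 0 ≤ ρ ^ j * a k := by
      have := (ha k).le
      positivity
    nlinarith

/-! ### Interleaved sequences -/

/-- The sequence `a 0, b 0, a 1, b 1, …`. -/
def interleave (a b : ℕ → ℝ) (k : ℕ) : ℝ := if k % 2 = 0 then a (k / 2) else b (k / 2)

@[simp]
theorem interleave_even (a b : ℕ → ℝ) (i : ℕ) : interleave a b (2 * i) = a i := by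
  simp [interleave]

@[simp]
theorem interleave_odd (a b : ℕ → ℝ) (i : ℕ) : interleave a b (2 * i + 1) = b i := by
  have h1 : (2 * i + 1) % 2 = 1 := by omega
  have h2 : (2 * i + 1) / 2 = i := by omega
  simp [interleave, h1, h2]

@[simp]
theorem interleave_even_add_two (a b : ℕ → ℝ) (i : ℕ) :
    interleave a b (2 * i + 2) = a (i + 1) := interleave_even a b (i + 1)

@[simp]
theorem interleave_odd_add_two (a b : ℕ → ℝ) (i : ℕ) :
    interleave a b (2 * i + 3) = b (i + 1) := interleave_odd a b (i + 1)

@[simp]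
theorem interleave_zero (a b : ℕ → ℝ) : interleave a b 0 = a 0 := interleave_even a b 0

@[simp]
theorem interleave_one (a b : ℕ → ℝ) : interleave a b 1 = b 0 := interleave_odd a b 0

theorem interleave_forall {P : ℝ → Prop} {a b : ℕ → ℝ} (ha : ∀ i, P (a i)) (hb : ∀ i, P (b i))
    (k : ℕ) : P (interleave a b k) := by
  obtain ⟨i, rfl | rfl⟩ := k.even_or_odd' <;> simp [ha, hb]

theorem interleave_succ_le {a b : ℕ → ℝ} (ha : ∀ k, 0 < a k) (hb : ∀ k, 0 < b k) {C D : ℝ}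
    (hC0 : 0 < C) (hD0 : 0 < D) (hC : ∀ k, a (k + 1) ≤ C * b k) (hD : ∀ k, b k ≤ D * a k)
    (k : ℕ) : interleave a b (k + 1) ≤ (C + D) * interleave a b k := by
  obtain ⟨i, rfl | rfl⟩ := k.even_or_odd'
  · simp only [interleave_even, interleave_odd]
    nlinarith [hD i, ha i]
  · simp only [interleave_even_add_two, interleave_odd, add_assoc, Nat.reduceAdd]
    nlinarith [hC i, hb i]

/-- Two steps of the interleaved sequence advance the index of `a` by one, so rate `r ^ 2` for `a`
becomes `r` here. Each `b k` is squeezed between `a (k + 1)` and `a k` up to constants. -/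
theorem interleave_geometric {a b : ℕ → ℝ} (ha : ∀ k, 0 < a k) (hb : ∀ k, 0 < b k) {C D K r : ℝ}
    (hC0 : 0 < C) (hD0 : 0 < D) (hK0 : 0 < K) (hC : ∀ k, a (k + 1) ≤ C * b k)
    (hD : ∀ k, b k ≤ D * a k) (hr0 : 0 < r) (hr1 : r < 1)
    (hK : ∀ k j, a (k + j) ≤ K * (r ^ 2) ^ j * a k) :
    ∃ L, 0 < L ∧ ∀ k j, interleave a b (k + j) ≤ L * r ^ j * interleave a b k := by
  have hw0 : ∀ k, 0 < interleave a b k := interleave_forall ha hb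
  have hup : ∀ k, interleave a b k ≤ (1 + D) * a (k / 2) := by
    intro k
    unfold interleave
    split_ifs
    · nlinarith [ha (k / 2)]
    · nlinarith [ha (k / 2), hD (k / 2)]
  have hlo : ∀ k, a (k / 2 + 1) ≤ C * (1 + D) * interleave a b k := by
    intro k
    unfold interleave
    split_ifs
    · have h1 := ha (k / 2)
      calc a (k / 2 + 1) ≤ C * b (k / 2) := hC _
        _ ≤ C * (D * a (k / 2)) := by gcongr; exact hD _
        _ ≤ C * (1 + D) * a (k / 2) := by nlinarith [mul_pos hC0 h1]
    · nlinarith [hC (k / 2), mul_pos (mul_pos hC0 hD0) (hb (k / 2))]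
  -- The power 3 is the worst rounding loss: if the halved index advances by `i + 1`, then `j ≤ 2 *
  -- i + 3`.
  set L₁ : ℝ := (1 + D) * (K * (C * (1 + D))) / r ^ 3 with hL₁
  have hL₁0 : 0 < L₁ := by positivity
  refine ⟨L₁ + (1 + D) / r, by positivity, fun k j => ?_⟩
  have hwk := hw0 k
  by_cases hlt : k / 2 + 1 ≤ (k + j) / 2
  · set i := (k + j) / 2 - (k / 2 + 1) with hi
    have e : (k + j) / 2 = k / 2 + 1 + i := by omega
    have hp : (r ^ 2) ^ i ≤ r ^ j / r ^ 3 := by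
      rw [le_div_iff₀ (by positivity), ← pow_mul, ← pow_add]
      exact pow_le_pow_of_le_one hr0.le hr1.le (by omega)
    calc interleave a b (k + j) ≤ (1 + D) * a ((k + j) / 2) := hup _
      _ ≤ (1 + D) * (K * (r ^ 2) ^ i * a (k / 2 + 1)) := by
        rw [e]
        gcongr
        exact hK _ _
      _ ≤ (1 + D) * (K * (r ^ j / r ^ 3) * (C * (1 + D) * interleave a b k)) := by
        gcongr
        · exact (ha _).le
        · exact hlo k
      _ = L₁ * r ^ j * interleave a b k := by
        rw [hL₁]
        ring
      _ ≤ _ := by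
        gcongr
        have : 0 < (1 + D) / r := by positivity
        linarith
  · have h1 : interleave a b (k + j) ≤ (1 + D) * interleave a b k := by
      rcases Nat.eq_zero_or_pos j with rfl | hj
      · simp only [add_zero]
        nlinarith
      · have hj1 : j = 1 := by omega
        have hk0 : k % 2 = 0 := by omega
        have h2 := hup (k + j)
        have h3 : (k + j) / 2 = k / 2 := by omega
        rw [h3] at h2
        have h4 : interleave a b k = a (k / 2) := by simp [interleave, hk0]
        rwa [h4]
    have hj1 : j ≤ 1 := by omega
    have h2 : r ≤ r ^ j := by
      simpa using pow_le_pow_of_le_one hr0.le hr1.le hj1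
    refine h1.trans ?_
    gcongr
    calc 1 + D = (1 + D) / r * r := by field_simp
      _ ≤ (1 + D) / r * r ^ j := by gcongr
      _ ≤ _ := by gcongr; linarith

/-! ### The two birth and death chains -/

section Chains

variable {a b : ℕ → ℝ} (ha : ∀ k, 0 < a k) (hb : ∀ k, 0 < b k) {C D K ρ : ℝ}
  (hC0 : 0 < C) (hD0 : 0 < D) (hK0 : 0 < K) (hρ0 : 0 < ρ) (hρ1 : ρ < 1)
  (hC : ∀ k, a (k + 1) ≤ C * b k) (hD : ∀ k, b k ≤ D * a k)
  (hK : ∀ k j, a (k + j) ≤ K * ρ ^ j * a k)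
  (hsum : HasSum a (∑' i, a i)) (hsumb : HasSum b (∑' i, b i))
  (h1 : ∑' i, a i + ∑' i, b i = 1)
include ha hb hC0 hD0 hK0 hρ0 hρ1 hC hD hK hsum hsumb h1

/-- Passing between neighbours `k` and `k + 1` of the marginal chain requires drawing `Y = k` in
between, so the conductance of that edge is `a k * b k / (a k + b k)`. -/
theorem marginal_chain_convergence :
    ∃ (B : ℕ → ℝ) (t : ℝ), 0 < t ∧ t < 1 ∧ ∀ G : ℕ → ℕ → ℝ, (∀ n k, |G n k| ≤ 1) →
      (∀ n, G (n + 1) 0 = a 0 / (a 0 + b 0) * G n 0 + b 0 / (a 0 + b 0) * G n 1) →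
      (∀ n k, G (n + 1) (k + 1) =
        a (k + 1) / (a (k + 1) + b k) * (a (k + 1) / (a (k + 1) + b (k + 1)) * G n (k + 1)
          + b (k + 1) / (a (k + 1) + b (k + 1)) * G n (k + 2))
        + b k / (a (k + 1) + b k) * (a k / (a k + b k) * G n k
          + b k / (a k + b k) * G n (k + 1))) →
      ∀ n k, |G n k - (a 0 * G n 0 + ∑' j, (a (j + 1) + b j) * G n (j + 1))| ≤ B k * t ^ n := by
  set w : ℕ → ℝ := fun k => Nat.casesOn k (a 0) (fun k => a (k + 1) + b k) with hwdef
  set c : ℕ → ℝ := fun k => a k * b k / (a k + b k) with hcdef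
  have hw_zero : w 0 = a 0 := rfl
  have hw_succ : ∀ k, w (k + 1) = a (k + 1) + b k := fun _ => rfl
  have hw : ∀ k, 0 < w k := by
    intro k
    cases k with
    | zero => exact ha 0
    | succ k => exact add_pos (ha _) (hb _)
  have hc : ∀ k, 0 < c k := fun k => div_pos (mul_pos (ha k) (hb k)) (add_pos (ha k) (hb k))
  have hcb : ∀ k, b k ≤ (1 + D) * c k := by
    intro k
    have h1 := ha k
    have h2 := hb k
    have h3 := hD k
    simp only [hcdef]
    rw [mul_div_assoc', le_div_iff₀ (by positivity)]
    nlinarith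
  have hca : ∀ k, c k ≤ a k := by
    intro k
    have h1 := ha k
    have h2 := hb k
    simp only [hcdef]
    rw [div_le_iff₀ (by positivity)]
    nlinarith
  have hws : HasSum w 1 := by
    have h2 := ((hasSum_nat_add_iff' 1).2 hsum).add hsumb
    have h3 : HasSum (fun k => w (k + 1)) (1 - w 0) := by
      have h4 : ∑' i, a i - ∑ i ∈ Finset.range 1, a i + ∑' i, b i = 1 - w 0 := by
        rw [Finset.range_one, Finset.sum_singleton, hw_zero]
        linarith
      rw [← h4]
      exact h2
    simpa using (hasSum_nat_add_iff' (f := w) 1).1 (by simpa using h3)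
  obtain ⟨B, t, ht0, ht1, hB⟩ := birthDeath_convergence (u := fun k => c k / w k)
    (d := fun k => c k / w (k + 1)) (w := w) (c := c) (K := (1 + C) * (1 + D))
    -- The division by `ρ` pays for comparing `a (k + 1)` with `c k`, which uses up one of the `j`
    -- steps; the `+ 1` covers `j = 0`.
    (L := K * C * (1 + D) / ρ + 1) (r := ρ) hw hc
    (fun k => mul_div_cancel₀ _ (hw k).ne') (fun k => mul_div_cancel₀ _ (hw (k + 1)).ne')
    (by
      intro k
      have h1 := ha k
      have h2 := hb k
      -- Both moves across this edge end by redrawing `X` given the same `Y = k`; the two outcomes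
      -- are complementary, which yields `u k + d k ≤ 1`.
      have h4 : c k / w k ≤ b k / (a k + b k) := by
        have : a k ≤ w k := by
          cases k with
          | zero => exact le_rfl
          | succ k => exact le_add_of_nonneg_right (hb k).le
        rw [div_le_div_iff₀ (hw k) (by positivity)]
        simp only [hcdef]
        rw [div_mul_cancel₀ _ (by positivity)]
        nlinarith
      have h5 : c k / w (k + 1) ≤ a k / (a k + b k) := by
        have : b k ≤ w (k + 1) := le_add_of_nonneg_left (ha (k + 1)).le
        rw [div_le_div_iff₀ (hw (k + 1)) (by positivity)]
        simp only [hcdef]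
        rw [div_mul_cancel₀ _ (by positivity)]
        nlinarith
      calc _ ≤ b k / (a k + b k) + a k / (a k + b k) := add_le_add h4 h5
        _ = 1 := by field_simp; ring) hρ0 hρ1
    (by
      intro k
      calc w (k + 1) = a (k + 1) + b k := rfl
        _ ≤ (1 + C) * b k := by linarith [hC k]
        _ ≤ (1 + C) * ((1 + D) * c k) := by gcongr; exact hcb k
        _ = _ := by ring)
    (by
      intro k j
      have hck := hc k
      cases j with
      | zero =>
        have : 0 < K * C * (1 + D) / ρ := by positivity
        simp only [add_zero, pow_zero, mul_one]
        nlinarith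
      | succ j =>
        calc c (k + (j + 1)) ≤ a (k + 1 + j) := by
              rw [show k + (j + 1) = k + 1 + j by ring]
              exact hca _
          _ ≤ K * ρ ^ j * a (k + 1) := hK _ _
          _ ≤ K * ρ ^ j * (C * ((1 + D) * c k)) := by
              gcongr
              exact (hC k).trans (by gcongr; exact hcb k)
          _ = K * C * (1 + D) / ρ * ρ ^ (j + 1) * c k := by
              rw [pow_succ]
              field_simp
          _ ≤ _ := by
              gcongr
              linarith) hws
  refine ⟨B, t, ht0, ht1, fun G hG hG0 hGk n k => ?_⟩
  have h2 := hB G hG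
    (by
      intro n
      rw [hG0 n]
      have h1 := ha 0
      have h2 := hb 0
      simp only [hcdef, hw_zero]
      field_simp
      ring)
    (by
      intro n k
      rw [hGk n k]
      have h1 := ha k
      have h2 := hb k
      have h3 := ha (k + 1)
      have h4 := hb (k + 1)
      simp only [hcdef, hw_succ]
      field_simp
      ring) n k
  have h3 : Summable fun j => w j * G n j := by
    refine Summable.of_norm_bounded hws.summable fun j => ?_
    rw [Real.norm_eq_abs, abs_mul, abs_of_pos (hw j)]
    exact mul_le_of_le_one_right (hw j).le (hG n j)
  rw [h3.tsum_eq_zero_add] at h2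
  exact h2

theorem path_chain_convergence {p : ℝ} (hp0 : 0 < p) (hp1 : p < 1) :
    ∃ (B : ℕ → ℝ) (t : ℝ), 0 < t ∧ t < 1 ∧ ∀ G G' : ℕ → ℕ → ℝ, (∀ n k, |G n k| ≤ 1) →
      (∀ n k, |G' n k| ≤ 1) →
      (∀ n, G (n + 1) 0 = p * (a 0 / (a 0 + b 0) * G n 0 + b 0 / (a 0 + b 0) * G' n 0)
        + (1 - p) * G n 0) →
      (∀ n k, G (n + 1) (k + 1) =
        p * (a (k + 1) / (a (k + 1) + b (k + 1)) * G n (k + 1)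
          + b (k + 1) / (a (k + 1) + b (k + 1)) * G' n (k + 1))
        + (1 - p) * (a (k + 1) / (a (k + 1) + b k) * G n (k + 1)
          + b k / (a (k + 1) + b k) * G' n k)) →
      (∀ n k, G' (n + 1) k =
        p * (a k / (a k + b k) * G n k + b k / (a k + b k) * G' n k)
        + (1 - p) * (a (k + 1) / (a (k + 1) + b k) * G n (k + 1)
          + b k / (a (k + 1) + b k) * G' n k)) →
      ∀ n k, |G n k - ∑' j, (a j * G n j + b j * G' n j)| ≤ B k * t ^ n ∧
        |G' n k - ∑' j, (a j * G n j + b j * G' n j)| ≤ B k * t ^ n := by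
  set w : ℕ → ℝ := interleave a b with hwdef
  have hw : ∀ k, 0 < w k := interleave_forall ha hb
  -- Even edges of the path keep `y` and are crossed by an `X`-update, chosen with probability `p`;
  -- odd edges keep `x` and are crossed by a `Y`-update. Each update redraws between the two ends of
  -- its edge, so `u k + d k = s k`.
  set s : ℕ → ℝ := interleave (fun _ => p) (fun _ => 1 - p) with hsdef
  have hs0 : ∀ k, 0 < s k := interleave_forall (fun _ => hp0) (fun _ => by linarith)
  have hs1 : ∀ k, s k ≤ 1 :=
    interleave_forall (P := fun x => x ≤ 1) (fun _ => hp1.le) (fun _ => by linarith)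
  have hsp : ∀ k, p * (1 - p) ≤ s k := by
    refine interleave_forall (P := fun x => p * (1 - p) ≤ x) (fun _ => ?_) (fun _ => ?_) <;>
    nlinarith
  have hpp : 0 < p * (1 - p) := mul_pos hp0 (by linarith)
  set c : ℕ → ℝ := fun k => s k * (w k * w (k + 1) / (w k + w (k + 1))) with hcdef
  have hc : ∀ k, 0 < c k := fun k =>
    mul_pos (hs0 k) (div_pos (mul_pos (hw k) (hw _)) (add_pos (hw k) (hw _)))
  set E : ℝ := (1 + (C + D)) / (p * (1 - p)) with hE
  have hE0 : 0 < E := by positivity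
  have hcE : ∀ k, w (k + 1) ≤ E * c k := by
    intro k
    have h2 := hw k
    have h3 := hw (k + 1)
    have h4 : w (k + 1) ≤ (C + D) * w k := interleave_succ_le ha hb hC0 hD0 hC hD k
    have h5 : w (k + 1) ≤ (1 + (C + D)) * (w k * w (k + 1) / (w k + w (k + 1))) := by
      rw [mul_div_assoc', le_div_iff₀ (by positivity)]
      nlinarith
    calc w (k + 1) ≤ (1 + (C + D)) * (w k * w (k + 1) / (w k + w (k + 1))) := h5
      _ = E * (p * (1 - p) * (w k * w (k + 1) / (w k + w (k + 1)))) := by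
        rw [hE]
        have := hpp.ne'
        rw [← mul_assoc, div_mul_cancel₀ _ this]
      _ ≤ E * c k := by
        simp only [hcdef]
        gcongr
        exact hsp k
  have hcw : ∀ k, c k ≤ w (k + 1) := by
    intro k
    have h2 := hw k
    have h3 := hw (k + 1)
    have h4 : w k * w (k + 1) / (w k + w (k + 1)) ≤ w (k + 1) := by
      rw [div_le_iff₀ (by positivity)]
      nlinarith
    have h5 : 0 < w k * w (k + 1) / (w k + w (k + 1)) := by positivity
    calc c k ≤ 1 * (w k * w (k + 1) / (w k + w (k + 1))) := by
          simp only [hcdef]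
          gcongr
          exact hs1 k
      _ ≤ _ := by linarith
  have hr0 : 0 < √ρ := Real.sqrt_pos.2 hρ0
  have hr1 : √ρ < 1 := by
    rw [Real.sqrt_lt' one_pos]
    simpa using hρ1
  obtain ⟨L, hL0, hL⟩ := interleave_geometric ha hb hC0 hD0 hK0 hC hD hr0 hr1
    (by rwa [Real.sq_sqrt hρ0.le])
  have hws : HasSum w 1 := by
    rw [← h1]
    exact HasSum.even_add_odd (by simpa [hwdef] using hsum) (by simpa [hwdef] using hsumb)
  obtain ⟨B, t, ht0, ht1, hB⟩ := birthDeath_convergence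
    (u := fun k => s k * (w (k + 1) / (w k + w (k + 1))))
    (d := fun k => s k * (w k / (w k + w (k + 1)))) (w := w) (c := c) (K := E)
    (L := L * E) (r := √ρ) hw hc
    (fun k => by simp only [hcdef]; ring) (fun k => by simp only [hcdef]; ring)
    (fun k => by
      have h2 := hw k
      have h3 := hw (k + 1)
      have : s k * (w (k + 1) / (w k + w (k + 1))) + s k * (w k / (w k + w (k + 1))) = s k := by
        field_simp
        ring
      rw [this]
      exact hs1 k) hr0 hr1 hcE
    (fun k j => by
      calc c (k + j) ≤ w (k + 1 + j) := by
            rw [show k + 1 + j = k + j + 1 by ring]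
            exact hcw _
        _ ≤ L * √ρ ^ j * w (k + 1) := hL _ _
        _ ≤ L * √ρ ^ j * (E * c k) := by
            gcongr
            exact hcE k
        _ = _ := by ring) hws
  refine ⟨fun k => max (B (2 * k)) (B (2 * k + 1)), t, ht0, ht1,
    fun G G' hG hG' hG0 hGk hGk' n k => ?_⟩
  have h2 := hB (fun n => interleave (G n) (G' n))
    (fun n => interleave_forall (P := fun x => |x| ≤ 1) (hG n) (hG' n))
    (by
      intro n
      have h1 := ha 0
      have h2 := hb 0
      simp only [interleave_zero, interleave_one, hwdef, hsdef, zero_add]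
      rw [hG0 n]
      field_simp
      ring)
    (by
      intro n k
      obtain ⟨i, rfl | rfl⟩ := k.even_or_odd'
      · have h1 := ha i
        have h2 := hb i
        have h3 := ha (i + 1)
        simp only [interleave_even, interleave_odd, interleave_even_add_two, hwdef, hsdef,
          add_assoc, Nat.reduceAdd]
        rw [hGk' n i]
        field_simp
        ring
      · have h1 := hb i
        have h2 := ha (i + 1)
        have h3 := hb (i + 1)
        simp only [interleave_odd_add_two, interleave_odd, interleave_even_add_two, hwdef, hsdef,
          add_assoc, Nat.reduceAdd]
        rw [hGk n i]
        field_simp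
        ring) n
  have hsG : Summable fun j => a j * G n j := by
    refine Summable.of_norm_bounded hsum.summable fun j => ?_
    rw [Real.norm_eq_abs, abs_mul, abs_of_pos (ha j)]
    exact mul_le_of_le_one_right (ha j).le (hG n j)
  have hsG' : Summable fun j => b j * G' n j := by
    refine Summable.of_norm_bounded hsumb.summable fun j => ?_
    rw [Real.norm_eq_abs, abs_mul, abs_of_pos (hb j)]
    exact mul_le_of_le_one_right (hb j).le (hG' n j)
  have h3 : ∑' j, w j * interleave (G n) (G' n) j = ∑' j, (a j * G n j + b j * G' n j) := by
    rw [hsG.tsum_add hsG']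
    refine HasSum.tsum_eq (HasSum.even_add_odd ?_ ?_)
    · simpa [hwdef] using hsG.hasSum
    · simpa [hwdef] using hsG'.hasSum
  rw [h3] at h2
  have ht : 0 ≤ t ^ n := by positivity
  constructor
  · have h4 := h2 (2 * k)
    rw [interleave_even] at h4
    exact h4.trans (mul_le_mul_of_nonneg_right (le_max_left _ _) ht)
  · have h4 := h2 (2 * k + 1)
    rw [interleave_odd] at h4
    exact h4.trans (mul_le_mul_of_nonneg_right (le_max_right _ _) ht)

end Chains

/-! ### The discrete family -/

section Density

variable (a b : ℕ+ → ℝ)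

@[simp]
theorem density_self (i : ℕ+) : density a b i i = a i := by simp [density]

theorem add_one_ne_self (i : ℕ+) : i + 1 ≠ i := (PNat.lt_add_right i 1).ne'

@[simp]
theorem density_add_one (i : ℕ+) : density a b (i + 1) i = b i := by
  simp [density, add_one_ne_self]

theorem density_eq_zero {x y : ℕ+} (h1 : x ≠ y) (h2 : x ≠ y + 1) : density a b x y = 0 := by
  simp [density, h1, h2]

theorem density_eq_zero_of_notMem {x y : ℕ+} (h : x ∉ ({y, y + 1} : Finset ℕ+)) :
    density a b x y = 0 := by
  simp only [Finset.mem_insert, Finset.mem_singleton, not_or] at h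
  exact density_eq_zero a b h.1 h.2

theorem density_one_eq_zero {y : ℕ+} (h : y ≠ 1) : density a b 1 y = 0 :=
  density_eq_zero a b h.symm (ne_of_lt (PNat.lt_add_left 1 y))

theorem density_succ_eq_zero {i y : ℕ+} (h : y ∉ ({i + 1, i} : Finset ℕ+)) :
    density a b (i + 1) y = 0 := by
  simp only [Finset.mem_insert, Finset.mem_singleton, not_or] at h
  exact density_eq_zero a b (Ne.symm h.1) fun e => h.2 (add_right_cancel e).symm

theorem margY_density (y : ℕ+) : margY (density a b) y = a y + b y := by
  rw [margY, tsum_eq_sum fun x hx => density_eq_zero_of_notMem a b hx,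
    Finset.sum_pair (add_one_ne_self y).symm, density_self, density_add_one]

theorem margX_density_one : margX (density a b) 1 = a 1 := by
  rw [margX, tsum_eq_single 1 fun y hy => density_one_eq_zero a b hy, density_self]

theorem margX_density_add_one (i : ℕ+) : margX (density a b) (i + 1) = a (i + 1) + b i := by
  rw [margX, tsum_eq_sum fun y hy => density_succ_eq_zero a b hy,
    Finset.sum_pair (add_one_ne_self i), density_self, density_add_one]

theorem eq_one_or_eq_add_one (x : ℕ+) : x = 1 ∨ ∃ i, x = i + 1 :=
  PNat.recOn x (Or.inl rfl) fun i _ => Or.inr ⟨i, rfl⟩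

variable {a b}

theorem isGibbsDensity_density (ha : ∀ i, 0 < a i) (hb : ∀ i, 0 < b i) :
    IsGibbsDensity (density a b) where
  nonneg x y := by
    unfold density
    split_ifs
    exacts [(ha x).le, (hb y).le, le_rfl]
  summable_left y := summable_of_ne_finset_zero fun x hx => density_eq_zero_of_notMem a b hx
  summable_right x := by
    rcases eq_one_or_eq_add_one x with rfl | ⟨i, rfl⟩
    · exact summable_of_ne_finset_zero (s := {1}) fun y hy =>
        density_one_eq_zero a b (by simpa using hy)
    · exact summable_of_ne_finset_zero fun y hy => density_succ_eq_zero a b hy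
  margX_pos x := by
    rcases eq_one_or_eq_add_one x with rfl | ⟨i, rfl⟩
    · rw [margX_density_one]
      exact ha 1
    · rw [margX_density_add_one]
      exact add_pos (ha _) (hb _)
  margY_pos y := by
    rw [margY_density]
    exact add_pos (ha _) (hb _)

theorem tsum_condX_density_mul (y : ℕ+) (g : ℕ+ → ℝ≥0∞) :
    ∑' x, ENNReal.ofReal (condX (density a b) x y) * g x
      = ENNReal.ofReal (a y / (a y + b y)) * g y
        + ENNReal.ofReal (b y / (a y + b y)) * g (y + 1) := by
  rw [tsum_eq_sum (s := {y, y + 1}) fun x hx => by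
    rw [condX, density_eq_zero_of_notMem a b hx]
    simp, Finset.sum_pair (add_one_ne_self y).symm]
  simp only [condX, density_self, density_add_one, margY_density]

theorem tsum_condY_density_one_mul (ha : ∀ i, 0 < a i) (g : ℕ+ → ℝ≥0∞) :
    ∑' y, ENNReal.ofReal (condY (density a b) y 1) * g y = g 1 := by
  rw [tsum_eq_single 1 fun y hy => by
    rw [condY, density_one_eq_zero a b hy]
    simp]
  simp [condY, margX_density_one, (ha 1).ne']

theorem tsum_condY_density_add_one_mul (i : ℕ+) (g : ℕ+ → ℝ≥0∞) :
    ∑' y, ENNReal.ofReal (condY (density a b) y (i + 1)) * g y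
      = ENNReal.ofReal (a (i + 1) / (a (i + 1) + b i)) * g (i + 1)
        + ENNReal.ofReal (b i / (a (i + 1) + b i)) * g i := by
  rw [tsum_eq_sum (s := {i + 1, i}) fun y hy => by
    rw [condY, density_succ_eq_zero a b hy]
    simp, Finset.sum_pair (add_one_ne_self i)]
  simp only [condY, density_self, density_add_one, margX_density_add_one]

theorem toReal_ofReal_mul_add {s t : ℝ} (hs : 0 ≤ s) (ht : 0 ≤ t) {x y : ℝ≥0∞} (hx : x ≤ 1)
    (hy : y ≤ 1) : (ENNReal.ofReal s * x + ENNReal.ofReal t * y).toReal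
      = s * x.toReal + t * y.toReal := by
  have hx' : x ≠ ⊤ := ne_top_of_le_ne_top ENNReal.one_ne_top hx
  have hy' : y ≠ ⊤ := ne_top_of_le_ne_top ENNReal.one_ne_top hy
  rw [ENNReal.toReal_add (ENNReal.mul_ne_top ENNReal.ofReal_ne_top hx')
    (ENNReal.mul_ne_top ENNReal.ofReal_ne_top hy'), ENNReal.toReal_mul, ENNReal.toReal_mul,
    ENNReal.toReal_ofReal hs, ENNReal.toReal_ofReal ht]

theorem abs_toReal_le_one {x : ℝ≥0∞} (hx : x ≤ 1) : |x.toReal| ≤ 1 := by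
  rw [abs_of_nonneg ENNReal.toReal_nonneg]
  exact ENNReal.toReal_le_of_le_ofReal zero_le_one (by simpa using hx)

theorem tsum_condX_mul_le_one {π : ℕ+ → ℕ+ → ℝ} (h : IsGibbsDensity π) (y : ℕ+)
    {g : ℕ+ → ℝ≥0∞} (hg : ∀ x, g x ≤ 1) : ∑' x, ENNReal.ofReal (condX π x y) * g x ≤ 1 := by
  rw [← h.tsum_condX y]
  exact ENNReal.tsum_le_tsum fun x => mul_le_of_le_one_right' (hg x)

theorem tsum_condY_mul_le_one {π : ℕ+ → ℕ+ → ℝ} (h : IsGibbsDensity π) (x : ℕ+)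
    {g : ℕ+ → ℝ≥0∞} (hg : ∀ y, g y ≤ 1) : ∑' y, ENNReal.ofReal (condY π y x) * g y ≤ 1 := by
  rw [← h.tsum_condY x]
  exact ENNReal.tsum_le_tsum fun y => mul_le_of_le_one_right' (hg y)

theorem tsum_pnat_eq_tsum_succPNat {R : Type*} [AddCommMonoid R] [TopologicalSpace R]
    (f : ℕ+ → R) : ∑' x, f x = ∑' k : ℕ, f k.succPNat :=
  (Equiv.pnatEquivNat.symm.tsum_eq f).symm

theorem summable_succPNat {f : ℕ+ → ℝ} (hf : Summable f) : Summable fun k : ℕ => f k.succPNat :=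
  hf.comp_injective Nat.succPNat_injective

theorem succPNat_add_one (k : ℕ) : (k + 1).succPNat = k.succPNat + 1 := rfl

end Density

/-! ### From the birth and death chains to the three samplers -/

theorem abs_convex_sub_le {u v X Y w A B : ℝ} (hu : 0 ≤ u) (hv : 0 ≤ v) (huv : u + v = 1)
    (hX : |X - w| ≤ A) (hY : |Y - w| ≤ B) : |u * X + v * Y - w| ≤ |A| + |B| := by
  have e : u * X + v * Y - w = u * (X - w) + v * (Y - w) := by
    linear_combination w * huv
  calc |u * X + v * Y - w| ≤ |u * (X - w)| + |v * (Y - w)| := by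
        rw [e]
        exact abs_add_le _ _
    _ = u * |X - w| + v * |Y - w| := by
        rw [abs_mul, abs_mul, abs_of_nonneg hu, abs_of_nonneg hv]
    _ ≤ |X - w| + |Y - w| :=
        add_le_add (mul_le_of_le_one_left (abs_nonneg _) (by linarith))
          (mul_le_of_le_one_left (abs_nonneg _) (by linarith))
    _ ≤ |A| + |B| := add_le_add (hX.trans (le_abs_self _)) (hY.trans (le_abs_self _))

/-- Growth conditions, valid along the whole sequence, under which the Gibbs samplers converge
geometrically. -/
structure GeometricGrowth (a b : ℕ+ → ℝ) (C D K ρ : ℝ) : Prop where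
  a_pos : ∀ i, 0 < a i
  b_pos : ∀ i, 0 < b i
  summable_a : Summable a
  summable_b : Summable b
  tsum_add : ∑' i, a i + ∑' i, b i = 1
  C_pos : 0 < C
  D_pos : 0 < D
  K_pos : 0 < K
  ρ_pos : 0 < ρ
  ρ_lt_one : ρ < 1
  a_le : ∀ k : ℕ, a (k + 1).succPNat ≤ C * b k.succPNat
  b_le : ∀ k : ℕ, b k.succPNat ≤ D * a k.succPNat
  a_geometric : ∀ k j : ℕ, a (k + j).succPNat ≤ K * ρ ^ j * a k.succPNat

namespace GeometricGrowth

variable {a b : ℕ+ → ℝ} {C D K ρ : ℝ} (h : GeometricGrowth a b C D K ρ)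
include h

theorem isGibbsDensity : IsGibbsDensity (density a b) := isGibbsDensity_density h.a_pos h.b_pos

theorem isProbabilityMeasure_target : IsProbabilityMeasure (target (density a b)) := by
  constructor
  have h1 := h.isGibbsDensity.lintegral_target_snd (fun _ => 1)
  simp only [lintegral_const, one_mul, mul_one, margY_density] at h1
  rw [h1, ← ENNReal.ofReal_tsum_of_nonneg (fun i => (add_pos (h.a_pos i) (h.b_pos i)).le)
    (h.summable_a.add h.summable_b), h.summable_a.tsum_add h.summable_b, h.tsum_add,
    ENNReal.ofReal_one]

theorem isProbabilityMeasure_targetX : IsProbabilityMeasure (targetX (density a b)) := by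
  constructor
  have h1 := h.isGibbsDensity.lintegral_target_fst (fun _ => 1)
  have h2 := lintegral_measureOfDensity (margX (density a b)) (fun _ => 1)
  rw [← h1] at h2
  have := h.isProbabilityMeasure_target
  simpa [targetX] using h2

/-- Formulated for any bounded solution of the backward recursion, so that it serves the
deterministic scan sampler as well as the marginal chain itself. -/
theorem X_convergence :
    ∃ (B : ℕ+ → ℝ) (t : ℝ), 0 < t ∧ t < 1 ∧ ∀ g : ℕ → ℕ+ → ℝ≥0∞, (∀ n x, g n x ≤ 1) →
      (∀ n x, g (n + 1) x = ∑' y, ENNReal.ofReal (condY (density a b) y x) *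
        ∑' x', ENNReal.ofReal (condX (density a b) x' y) * g n x') →
      ∀ n x, |(g n x).toReal
        - (∑' x, ENNReal.ofReal (margX (density a b) x) * g n x).toReal| ≤ B x * t ^ n := by
  have hG := h.isGibbsDensity
  obtain ⟨B, t, ht0, ht1, hB⟩ := marginal_chain_convergence (fun k : ℕ => h.a_pos k.succPNat)
    (fun k : ℕ => h.b_pos k.succPNat) h.C_pos h.D_pos h.K_pos h.ρ_pos h.ρ_lt_one h.a_le h.b_le
    h.a_geometric (summable_succPNat h.summable_a).hasSum (summable_succPNat h.summable_b).hasSum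
    (by rw [← tsum_pnat_eq_tsum_succPNat, ← tsum_pnat_eq_tsum_succPNat, h.tsum_add])
  refine ⟨fun x => B x.natPred, t, ht0, ht1, fun g hg hrec n x => ?_⟩
  have ha0 : ∀ i, 0 ≤ a i := fun i => (h.a_pos i).le
  have hb0 : ∀ i, 0 ≤ b i := fun i => (h.b_pos i).le
  have hX : ∀ n y, (∑' x', ENNReal.ofReal (condX (density a b) x' y) * g n x').toReal
      = a y / (a y + b y) * (g n y).toReal + b y / (a y + b y) * (g n (y + 1)).toReal := by
    intro n y
    rw [tsum_condX_density_mul, toReal_ofReal_mul_add (div_nonneg (ha0 _)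
      (add_nonneg (ha0 _) (hb0 _))) (div_nonneg (hb0 _) (add_nonneg (ha0 _) (hb0 _)))
      (hg _ _) (hg _ _)]
  have h1 := hB (fun n k => (g n k.succPNat).toReal) (fun n k => abs_toReal_le_one (hg _ _))
    (fun n => by
      rw [hrec, show Nat.succPNat 0 = 1 from rfl, tsum_condY_density_one_mul h.a_pos, hX]
      rfl)
    (fun n k => by
      rw [hrec, succPNat_add_one, tsum_condY_density_add_one_mul, toReal_ofReal_mul_add
        (div_nonneg (ha0 _) (add_nonneg (ha0 _) (hb0 _)))
        (div_nonneg (hb0 _) (add_nonneg (ha0 _) (hb0 _)))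
        (tsum_condX_mul_le_one hG _ (hg n)) (tsum_condX_mul_le_one hG _ (hg n)), hX, hX]
      rfl) n x.natPred
  simp only [PNat.succPNat_natPred] at h1
  have h2 : (∑' x, ENNReal.ofReal (margX (density a b) x) * g n x).toReal
      = a 1 * (g n 1).toReal + ∑' j : ℕ, (a (j + 1).succPNat + b j.succPNat)
        * (g n (j + 1).succPNat).toReal := by
    have hne : ∀ x, ENNReal.ofReal (margX (density a b) x) * g n x ≠ ⊤ := fun x =>
      ENNReal.mul_ne_top ENNReal.ofReal_ne_top (ne_top_of_le_ne_top ENNReal.one_ne_top (hg n x))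
    have hmass := h.isProbabilityMeasure_target
    have hfin : ∑' x, ENNReal.ofReal (margX (density a b) x) * g n x ≠ ⊤ := by
      rw [← hG.lintegral_target_fst]
      refine ne_top_of_le_ne_top ENNReal.one_ne_top ?_
      calc ∫⁻ z, g n z.1 ∂target (density a b) ≤ ∫⁻ _, 1 ∂target (density a b) :=
            lintegral_mono fun z => hg n z.1
        _ = 1 := by simp
    have hs := ENNReal.summable_toReal hfin
    rw [ENNReal.tsum_toReal_eq hne, tsum_pnat_eq_tsum_succPNat,
      (summable_succPNat hs).tsum_eq_zero_add]
    congr 1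
    · rw [show Nat.succPNat 0 = 1 from rfl, margX_density_one, ENNReal.toReal_mul,
        ENNReal.toReal_ofReal (ha0 1)]
    · refine tsum_congr fun j => ?_
      rw [ENNReal.toReal_mul, succPNat_add_one, margX_density_add_one,
        ENNReal.toReal_ofReal (add_nonneg (ha0 _) (hb0 _))]
  rw [h2]
  exact h1

theorem geometricallyErgodic_kernelX :
    GeometricallyErgodic (kernelX (density a b)) (targetX (density a b)) := by
  have hG := h.isGibbsDensity
  have := h.isProbabilityMeasure_targetX
  have := hG.isMarkovKernel_kernelX
  obtain ⟨B, t, ht0, ht1, hB⟩ := h.X_convergence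
  refine GeometricallyErgodic.of_forall_set hG.invariant_kernelX ht0 ht1
    (B := B) fun S hS z n => ?_
  have h1 := hB (fun n x => nStep (kernelX (density a b)) n x S) (fun n x => prob_le_one)
    (fun n x => by rw [nStep_succ_apply _ _ _ hS, hG.lintegral_kernelX]) n z
  rw [← lintegral_measureOfDensity, ← targetX, lintegral_nStep hG.invariant_kernelX n hS] at h1
  exact h1

theorem geometricallyErgodic_kernelDGS :
    GeometricallyErgodic (kernelDGS (density a b)) (target (density a b)) := by
  have hG := h.isGibbsDensity
  have := h.isProbabilityMeasure_target
  have := hG.isMarkovKernel_kernelDGS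
  obtain ⟨B, t, ht0, ht1, hB⟩ := h.X_convergence
  have ha0 : ∀ i, 0 ≤ a i := fun i => (h.a_pos i).le
  have hb0 : ∀ i, 0 ≤ b i := fun i => (h.b_pos i).le
  -- The 1 handles `n = 0`; dividing by `t` compensates for the first step, which moves to `x' = y`
  -- or `x' = y + 1`.
  refine GeometricallyErgodic.of_forall_set hG.invariant_kernelDGS ht0 ht1
    (B := fun z => 1 + (|B z.2| + |B (z.2 + 1)|) / t) fun S hS z n => ?_
  -- The next step forgets `x`, so the average of the iterates over `y` given `x` is a function of
  -- `x` alone that obeys the marginal recursion.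
  have hmain := hB (fun n x => ∑' y, ENNReal.ofReal (condY (density a b) y x) *
      nStep (kernelDGS (density a b)) n (x, y) S)
    (fun n x => tsum_condY_mul_le_one hG x fun y => prob_le_one)
    (fun n x => by simp only [nStep_succ_apply _ _ _ hS, hG.lintegral_kernelDGS])
  have hmass : ∀ n, ∑' x, ENNReal.ofReal (margX (density a b) x) *
      ∑' y, ENNReal.ofReal (condY (density a b) y x) *
        nStep (kernelDGS (density a b)) n (x, y) S = target (density a b) S := fun n => by
    rw [← lintegral_nStep hG.invariant_kernelDGS n hS, hG.lintegral_target_eq_X]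
  simp only [hmass] at hmain
  rcases n with _ | n
  · refine (abs_real_sub_real_le_one _ _ S).trans ?_
    rw [pow_zero, mul_one]
    have : 0 ≤ (|B z.2| + |B (z.2 + 1)|) / t := by positivity
    linarith
  · have e : (nStep (kernelDGS (density a b)) (n + 1) z).real S
        = a z.2 / (a z.2 + b z.2) * (∑' y, ENNReal.ofReal (condY (density a b) y z.2) *
          nStep (kernelDGS (density a b)) n (z.2, y) S).toReal
        + b z.2 / (a z.2 + b z.2) * (∑' y, ENNReal.ofReal (condY (density a b) y (z.2 + 1)) *
          nStep (kernelDGS (density a b)) n (z.2 + 1, y) S).toReal := by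
      rw [measureReal_def, nStep_succ_apply _ _ _ hS, hG.lintegral_kernelDGS,
        tsum_condX_density_mul, toReal_ofReal_mul_add
        (div_nonneg (ha0 _) (add_nonneg (ha0 _) (hb0 _)))
        (div_nonneg (hb0 _) (add_nonneg (ha0 _) (hb0 _)))
        (tsum_condY_mul_le_one hG _ fun y => prob_le_one)
        (tsum_condY_mul_le_one hG _ fun y => prob_le_one)]
    rw [e]
    have h1 := hmain n z.2
    have h2 := hmain n (z.2 + 1)
    rw [← measureReal_def] at h1 h2
    set w := (target (density a b)).real S
    set X := (∑' y, ENNReal.ofReal (condY (density a b) y z.2) *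
          nStep (kernelDGS (density a b)) n (z.2, y) S).toReal
    set Y := (∑' y, ENNReal.ofReal (condY (density a b) y (z.2 + 1)) *
          nStep (kernelDGS (density a b)) n (z.2 + 1, y) S).toReal
    have hpa := h.a_pos z.2
    have hpb := h.b_pos z.2
    have hu : a z.2 / (a z.2 + b z.2) + b z.2 / (a z.2 + b z.2) = 1 := by field_simp
    calc _ ≤ |B z.2 * t ^ n| + |B (z.2 + 1) * t ^ n| :=
          abs_convex_sub_le (by positivity) (by positivity) hu h1 h2
      _ = (|B z.2| + |B (z.2 + 1)|) * t ^ n := by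
          rw [abs_mul, abs_mul, abs_of_pos (pow_pos ht0 n)]
          ring
      _ = (|B z.2| + |B (z.2 + 1)|) / t * t ^ (n + 1) := by
          rw [pow_succ]
          field_simp
      _ ≤ _ := by
          gcongr
          linarith

/-- Convergence of the random scan sampler started on the support of the target. -/
theorem RGS_convergence {p : ℝ} (hp0 : 0 < p) (hp1 : p < 1) :
    ∃ (B : ℕ+ → ℝ) (t : ℝ), 0 < t ∧ t < 1 ∧ ∀ S, MeasurableSet S → ∀ n i,
      |(nStep (kernelRGS (density a b) p) n (i, i)).real S
          - (target (density a b)).real S| ≤ B i * t ^ n ∧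
      |(nStep (kernelRGS (density a b) p) n (i + 1, i)).real S
          - (target (density a b)).real S| ≤ B i * t ^ n := by
  have hG := h.isGibbsDensity
  have := h.isProbabilityMeasure_target
  have := hG.isMarkovKernel_kernelRGS hp0.le hp1.le
  obtain ⟨B, t, ht0, ht1, hB⟩ := path_chain_convergence (fun k : ℕ => h.a_pos k.succPNat)
    (fun k : ℕ => h.b_pos k.succPNat) h.C_pos h.D_pos h.K_pos h.ρ_pos h.ρ_lt_one h.a_le h.b_le
    h.a_geometric (summable_succPNat h.summable_a).hasSum (summable_succPNat h.summable_b).hasSum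
    (by rw [← tsum_pnat_eq_tsum_succPNat, ← tsum_pnat_eq_tsum_succPNat, h.tsum_add]) hp0 hp1
  refine ⟨fun x => B x.natPred, t, ht0, ht1, fun S hS n i => ?_⟩
  have ha0 : ∀ i, 0 ≤ a i := fun i => (h.a_pos i).le
  have hb0 : ∀ i, 0 ≤ b i := fun i => (h.b_pos i).le
  set g : ℕ → ℕ+ × ℕ+ → ℝ≥0∞ := fun n z => nStep (kernelRGS (density a b) p) n z S with hg
  have hg1 : ∀ n z, g n z ≤ 1 := fun n z => prob_le_one
  have hX : ∀ n y, (∑' x', ENNReal.ofReal (condX (density a b) x' y) * g n (x', y)).toReal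
      = a y / (a y + b y) * (g n (y, y)).toReal
        + b y / (a y + b y) * (g n (y + 1, y)).toReal := by
    intro n y
    rw [tsum_condX_density_mul y (fun x' => g n (x', y)), toReal_ofReal_mul_add (div_nonneg (ha0 _)
      (add_nonneg (ha0 _) (hb0 _))) (div_nonneg (hb0 _) (add_nonneg (ha0 _) (hb0 _)))
      (hg1 _ _) (hg1 _ _)]
  have hY : ∀ n i, (∑' y, ENNReal.ofReal (condY (density a b) y (i + 1)) *
      g n (i + 1, y)).toReal
      = a (i + 1) / (a (i + 1) + b i) * (g n (i + 1, i + 1)).toReal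
        + b i / (a (i + 1) + b i) * (g n (i + 1, i)).toReal := by
    intro n i
    rw [tsum_condY_density_add_one_mul i (fun y => g n (i + 1, y)), toReal_ofReal_mul_add
      (div_nonneg (ha0 _) (add_nonneg (ha0 _) (hb0 _)))
      (div_nonneg (hb0 _) (add_nonneg (ha0 _) (hb0 _))) (hg1 _ _) (hg1 _ _)]
  have hrec : ∀ n z, (g (n + 1) z).toReal
      = p * (∑' x', ENNReal.ofReal (condX (density a b) x' z.2) * g n (x', z.2)).toReal
        + (1 - p) * (∑' y', ENNReal.ofReal (condY (density a b) y' z.1) *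
          g n (z.1, y')).toReal := by
    intro n z
    simp only [hg]
    rw [nStep_succ_apply _ _ _ hS, hG.lintegral_kernelRGS hp0.le hp1.le,
      toReal_ofReal_mul_add hp0.le (by linarith)
        (tsum_condX_mul_le_one hG _ fun _ => prob_le_one)
        (tsum_condY_mul_le_one hG _ fun _ => prob_le_one)]
  have h1 := hB (fun n k => (g n (k.succPNat, k.succPNat)).toReal)
    (fun n k => (g n (k.succPNat + 1, k.succPNat)).toReal)
    (fun n k => abs_toReal_le_one (hg1 _ _)) (fun n k => abs_toReal_le_one (hg1 _ _))
    (fun n => by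
      rw [hrec, show Nat.succPNat 0 = 1 from rfl, tsum_condY_density_one_mul h.a_pos, hX])
    (fun n k => by
      rw [hrec, hX, succPNat_add_one, hY])
    (fun n k => by
      rw [hrec, hX, succPNat_add_one, hY]) n i.natPred
  simp only [PNat.succPNat_natPred] at h1
  have h2 : (target (density a b)).real S
      = ∑' j : ℕ, (a j.succPNat * (g n (j.succPNat, j.succPNat)).toReal
        + b j.succPNat * (g n (j.succPNat + 1, j.succPNat)).toReal) := by
    rw [measureReal_def, ← lintegral_nStep (hG.invariant_kernelRGS hp0.le hp1.le) n hS,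
      hG.lintegral_target_eq_Y, ENNReal.tsum_toReal_eq, tsum_pnat_eq_tsum_succPNat]
    · refine tsum_congr fun j => ?_
      have hpa := h.a_pos j.succPNat
      have hpb := h.b_pos j.succPNat
      rw [ENNReal.toReal_mul, hX, margY_density,
        ENNReal.toReal_ofReal (add_nonneg (ha0 _) (hb0 _))]
      field_simp
    · intro y
      exact ENNReal.mul_ne_top ENNReal.ofReal_ne_top (ne_top_of_le_ne_top ENNReal.one_ne_top
        (tsum_condX_mul_le_one hG _ fun _ => hg1 n _))
  rw [h2]
  exact h1

theorem geometricallyErgodic_kernelRGS {p : ℝ} (hp0 : 0 < p) (hp1 : p < 1) :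
    GeometricallyErgodic (kernelRGS (density a b) p) (target (density a b)) := by
  have hG := h.isGibbsDensity
  have := h.isProbabilityMeasure_target
  have := hG.isMarkovKernel_kernelRGS hp0.le hp1.le
  obtain ⟨B, t, ht0, ht1, hB⟩ := h.RGS_convergence hp0 hp1
  have ha0 : ∀ i, 0 ≤ a i := fun i => (h.a_pos i).le
  have hb0 : ∀ i, 0 ≤ b i := fun i => (h.b_pos i).le
  -- Whatever the start, an `X`-update leads to `(y, y)` or `(y + 1, y)`, and a `Y`-update likewise
  -- reaches the support, so the on-support bounds apply after one step.
  have hX : ∀ y, ∃ c : ℝ, ∀ S, MeasurableSet S → ∀ n,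
      |(∑' x', ENNReal.ofReal (condX (density a b) x' y) *
          nStep (kernelRGS (density a b) p) n (x', y) S).toReal
        - (target (density a b)).real S| ≤ c * t ^ n := by
    intro y
    refine ⟨|B y| + |B y|, fun S hS n => ?_⟩
    have hpa := h.a_pos y
    have hpb := h.b_pos y
    rw [tsum_condX_density_mul y (fun x' => nStep (kernelRGS (density a b) p) n (x', y) S),
      toReal_ofReal_mul_add (div_nonneg (ha0 _) (add_nonneg (ha0 _) (hb0 _)))
      (div_nonneg (hb0 _) (add_nonneg (ha0 _) (hb0 _))) prob_le_one prob_le_one]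
    refine (abs_convex_sub_le (by positivity) (by positivity) (by field_simp)
      (hB S hS n y).1 (hB S hS n y).2).trans (le_of_eq ?_)
    rw [abs_mul, abs_of_pos (pow_pos ht0 n)]
    ring
  have hY : ∀ x, ∃ c : ℝ, ∀ S, MeasurableSet S → ∀ n,
      |(∑' y', ENNReal.ofReal (condY (density a b) y' x) *
          nStep (kernelRGS (density a b) p) n (x, y') S).toReal
        - (target (density a b)).real S| ≤ c * t ^ n := by
    intro x
    rcases eq_one_or_eq_add_one x with rfl | ⟨i, rfl⟩
    · refine ⟨B 1, fun S hS n => ?_⟩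
      rw [tsum_condY_density_one_mul h.a_pos
        (fun y' => nStep (kernelRGS (density a b) p) n (1, y') S)]
      exact (hB S hS n 1).1
    · refine ⟨|B (i + 1)| + |B i|, fun S hS n => ?_⟩
      have hpa := h.a_pos (i + 1)
      have hpb := h.b_pos i
      rw [tsum_condY_density_add_one_mul i
        (fun y' => nStep (kernelRGS (density a b) p) n (i + 1, y') S),
        toReal_ofReal_mul_add (div_nonneg (ha0 _) (add_nonneg (ha0 _) (hb0 _)))
        (div_nonneg (hb0 _) (add_nonneg (ha0 _) (hb0 _))) prob_le_one prob_le_one]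
      refine (abs_convex_sub_le (by positivity) (by positivity) (by field_simp)
        (hB S hS n (i + 1)).1 (hB S hS n i).2).trans (le_of_eq ?_)
      rw [abs_mul, abs_mul, abs_of_pos (pow_pos ht0 n)]
      ring
  choose BX hBX using hX
  choose BY hBY using hY
  refine GeometricallyErgodic.of_forall_set (hG.invariant_kernelRGS hp0.le hp1.le) ht0 ht1
    (B := fun z => 1 + (|BX z.2| + |BY z.1|) / t) fun S hS z n => ?_
  rcases n with _ | n
  · refine (abs_real_sub_real_le_one _ _ S).trans ?_
    rw [pow_zero, mul_one]
    have : 0 ≤ (|BX z.2| + |BY z.1|) / t := by positivity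
    linarith
  · have hp1' : 0 ≤ 1 - p := by linarith
    rw [measureReal_def, nStep_succ_apply _ _ _ hS, hG.lintegral_kernelRGS hp0.le hp1.le,
      toReal_ofReal_mul_add hp0.le hp1' (tsum_condX_mul_le_one hG _ fun _ => prob_le_one)
        (tsum_condY_mul_le_one hG _ fun _ => prob_le_one)]
    calc _ ≤ |BX z.2 * t ^ n| + |BY z.1 * t ^ n| :=
          abs_convex_sub_le hp0.le hp1' (by ring) (hBX z.2 S hS n) (hBY z.1 S hS n)
      _ = (|BX z.2| + |BY z.1|) * t ^ n := by
          rw [abs_mul, abs_mul, abs_of_pos (pow_pos ht0 n)]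
          ring
      _ = (|BX z.2| + |BY z.1|) / t * t ^ (n + 1) := by
          rw [pow_succ]
          field_simp
      _ ≤ _ := by
          gcongr
          linarith

end GeometricGrowth

theorem exists_geometricGrowth (a b : ℕ+ → ℝ) (ha : ∀ i, 0 < a i) (hb : ∀ i, 0 < b i)
    (hsa : Summable a) (hsb : Summable b) (hsum : ∑' i, a i + ∑' i, b i = 1)
    (hab : limsupENN (fun i => a (i + 1) / b i) < ⊤)
    (hba : limsupENN (fun i => b i / a i) < ⊤)
    (hAMm : limsupENN (fun i => a (i + 1) / a i) * (1 + limsupENN (fun i => a i / b i))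
      / (1 + liminfENN (fun i => a i / b i)) < 1) :
    ∃ C D K ρ, GeometricGrowth a b C D K ρ := by
  obtain ⟨C, hC0, hC⟩ := exists_forall_le_of_limsupENN_lt_top hab
  obtain ⟨D, hD0, hD⟩ := exists_forall_le_of_limsupENN_lt_top hba
  have hC' : ∀ k : ℕ, a (k + 1).succPNat ≤ C * b k.succPNat := fun k => by
    have := hC k
    rwa [div_le_iff₀ (hb _)] at this
  have hD' : ∀ k : ℕ, b k.succPNat ≤ D * a k.succPNat := fun k => by
    have := hD k
    rwa [div_le_iff₀ (ha _)] at this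
  obtain ⟨ρ, hρ0, hρ1, hρ⟩ := exists_eventually_ratio_le ha hb hC0
    (Eventually.of_forall fun i => by
      have := hC' i.natPred
      rwa [succPNat_add_one, PNat.succPNat_natPred] at this) rfl rfl rfl hAMm
  have ht : Tendsto Nat.succPNat atTop atTop :=
    OrderIso.pnatIsoNat.symm.tendsto_atTop
  obtain ⟨K, hK0, hK⟩ := exists_geometric_of_eventually (fun k : ℕ => ha k.succPNat) hρ0
    (ht.eventually hρ)
  exact ⟨C, D, K, ρ, ha, hb, hsa, hsb, hsum, hC0, hD0, hK0, hρ0, hρ1, hC', hD', hK⟩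

end GibbsDiscrete

theorem mainTheorem6 (a b : ℕ+ → ℝ) (ha : ∀ i, 0 < a i) (hb : ∀ i, 0 < b i)
    (hsa : Summable a) (hsb : Summable b) (hsum : ∑' i, a i + ∑' i, b i = 1)
    (p : ℝ) (hp0 : 0 < p) (hp1 : p < 1)
    (hab : GibbsDiscrete.limsupENN (fun i => a (i + 1) / b i) < ⊤)
    (hba : GibbsDiscrete.limsupENN (fun i => b i / a i) < ⊤)
    (A m M : ℝ≥0∞)
    (hA : A = GibbsDiscrete.limsupENN (fun i => a (i + 1) / a i))
    (hm : m = GibbsDiscrete.liminfENN (fun i => a i / b i))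
    (hM : M = GibbsDiscrete.limsupENN (fun i => a i / b i))
    (hAMm : A * (1 + M) / (1 + m) < 1) :
    GibbsDiscrete.GeometricallyErgodic
        (GibbsDiscrete.kernelX (GibbsDiscrete.density a b))
        (GibbsDiscrete.targetX (GibbsDiscrete.density a b)) ∧
    GibbsDiscrete.GeometricallyErgodic
        (GibbsDiscrete.kernelDGS (GibbsDiscrete.density a b))
        (GibbsDiscrete.target (GibbsDiscrete.density a b)) ∧
    GibbsDiscrete.GeometricallyErgodic
        (GibbsDiscrete.kernelRGS (GibbsDiscrete.density a b) p)
        (GibbsDiscrete.target (GibbsDiscrete.density a b)) := by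
  subst hA hm hM
  obtain ⟨C, D, K, ρ, h⟩ :=
    GibbsDiscrete.exists_geometricGrowth a b ha hb hsa hsb hsum hab hba hAMm
  exact ⟨h.geometricallyErgodic_kernelX, h.geometricallyErgodic_kernelDGS,
    h.geometricallyErgodic_kernelRGS hp0 hp1⟩
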